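/- Let $K,N,P\ge 1$ be integers. For a finite field $\mathbb F_q$ and $L\ge 1$, let $K$ files $W_1,\dots,W_K$ be independent and uniform in $\mathbb F_q^L$, each replicated on $N$ servers. Let $\mathcal T$ be the set of the $K(K+1)/2$ unordered pairs $\{i,j\}$ with $i,j\in\{1,\dots,K\}$ ($i=j$ allowed), and for $\mathcal P\subseteq\mathcal T$ let $X_{\mathcal P}=(\langle W_i,W_j\rangle)_{\{i,j\}\in\mathcal P}$. For each $\mathcal P$ with $|\mathcal P|=P$, a user draws discrete random queries $(Q^{[\mathcal P]}_1,\dots,Q^{[\mathcal P]}_N)$, independent of the files; server $n$ returns a discrete answer $A^{[\mathcal P]}_n$ that is a function of $Q^{[\mathcal P]}_n$ and of the files. A protocol is admissible if (correctness) for each such $\mathcal P$ all queries and answers together almost surely determine $X_{\mathcal P}$, and (privacy) for each $n$ the joint law of $(Q^{[\mathcal P]}_n,A^{[\mathcal P]}_n,W_1,\dots,W_K)$ is the same for all $\mathcal P$ with $|\mathcal P|=P$. Its rate is $$\min_{\mathcal P\subseteq\mathcal T,\ |\mathcal P|=P}\ \frac{H(X_{\mathcal P})}{\sum_{n=1}^N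 H(A^{[\mathcal P]}_n)},$$ where $H$ is Shannon entropy, and the capacity $C=C_{q,L}(K,N,P)$ is the supremum of the rates of all admissible protocols. Suppose that $\frac{K(K+1)}{2P}$ is an integer and put $$S=1+\frac1N+\dots+\frac1{N^{\frac{K(K+1)}{2P}-1}}.$$ Then $1/C$ tends to $S$ as $L\to\infty$, for large enough $q$, in the following precise sense. 1. For every finite field $\mathbb F_q$, $\ \liminf_{L\to\infty}1/C_{q,L}\ge S$. 2. There is an integer $m\ge1$, depending only on $K,N,P$, such that for every finite field $\mathbb F_q$ with $q=b^m$ for some integer $b$, $\ \lim_{L\to\infty}1/C_{q,L}=S$. 3. For every $\varepsilon>0$ there is $q_0$, depending only on $K,N,P,\varepsilon$, such that for every finite field $\mathbb F_q$ with $q\ge q_0$, $\ \limsup_{L\to\infty}1/C_{q,L}\le S+\varepsilon$. -/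

import Mathlib

open Filter Topology
open scoped ENNReal

namespace InnerProductRetrieval

/-- Shannon entropy of a discrete probability law, in nats, as an extended nonnegative real
(the base of the logarithm cancels in every rate below). -/
noncomputable def entropy {α : Type*} (p : PMF α) : ℝ≥0∞ :=
  ∑' a, ENNReal.ofReal (Real.negMulLog (p a).toReal)

/-- `K` data files, each a vector of length `L` over `F`. -/
abbrev Files (F : Type*) (K L : ℕ) := Fin K → Fin L → F

/-- The inner product of the two files indexed by an unordered pair `{i, j}`
(with `i = j` allowed). -/
def innerProd {F : Type*} [Field F] {K L : ℕ} (W : Files F K L) : Sym2 (Fin K) → F :=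
  Sym2.lift ⟨fun i j => ∑ l, W i l * W j l, fun i j => by simp only [mul_comm]⟩

/-- A request: a set of exactly `P` unordered pairs `{i, j}`, `i, j` in `{1, …, K}`. -/
abbrev Request (K P : ℕ) := {s : Finset (Sym2 (Fin K)) // s.card = P}

/-- The requested inner products. -/
def requested {F : Type*} [Field F] {K L P : ℕ} (R : Request K P) (W : Files F K L) :
    R.1 → F :=
  fun t => innerProd W t

/-- The files are independent and uniformly distributed. -/
noncomputable def filesLaw (F : Type*) [Field F] [Fintype F] (K L : ℕ) : PMF (Files F K L) :=
  PMF.uniformOfFintype (Files F K L)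

/-- A retrieval protocol with `N` servers. For each request the user draws a (jointly
distributed) tuple of queries, one for each server; server `n` answers with a function of the
query it receives and of the files. Queries and answers are discrete; their countable alphabets
are labelled by natural numbers. -/
structure Protocol (F : Type*) (K L N P : ℕ) where
  queryLaw : Request K P → PMF (Fin N → ℕ)
  answer : Fin N → ℕ → Files F K L → ℕ

namespace Protocol

variable {F : Type*} [Field F] [Fintype F] {K L N P : ℕ}

/-- The joint law of all queries and the files: the queries are independent of the files. -/
noncomputable def law (S : Protocol F K L N P) (R : Request K P) :
    PMF ((Fin N → ℕ) × Files F K L) :=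
  (S.queryLaw R).bind fun q => (filesLaw F K L).map fun W => (q, W)

/-- The tuple of all answers. -/
def answers (S : Protocol F K L N P) (q : Fin N → ℕ) (W : Files F K L) : Fin N → ℕ :=
  fun n => S.answer n (q n) W

/-- The law of the answer of server `n`. -/
noncomputable def answerLaw (S : Protocol F K L N P) (R : Request K P) (n : Fin N) : PMF ℕ :=
  (S.law R).map fun x => S.answer n (x.1 n) x.2

/-- The joint law of the query to server `n`, its answer, and all the files. -/
noncomputable def serverLaw (S : Protocol F K L N P) (R : Request K P) (n : Fin N) :
    PMF (ℕ × ℕ × Files F K L) :=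
  (S.law R).map fun x => (x.1 n, S.answer n (x.1 n) x.2, x.2)

/-- Correctness: almost surely, the requested inner products are computed from all the queries
and all the answers. -/
def IsCorrect (S : Protocol F K L N P) : Prop :=
  ∀ R : Request K P, ∃ decode : (Fin N → ℕ) → (Fin N → ℕ) → (R.1 → F),
    ∀ x ∈ (S.law R).support, decode x.1 (S.answers x.1 x.2) = requested R x.2

/-- Privacy: for each server, the joint law of its query, its answer and the files does not
depend on the request. -/
def IsPrivate (S : Protocol F K L N P) : Prop :=
  ∀ (R₁ R₂ : Request K P) (n : Fin N), S.serverLaw R₁ n = S.serverLaw R₂ n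

/-- The retrieval rate: entropy of the requested inner products over total entropy of the
answers, minimized over all requests. -/
noncomputable def rate (S : Protocol F K L N P) : ℝ≥0∞ :=
  ⨅ R : Request K P,
    entropy ((filesLaw F K L).map (requested R)) / ∑ n, entropy (S.answerLaw R n)

end Protocol

/-- The capacity: the supremum of the rates of all correct and private protocols. -/
noncomputable def capacity (F : Type*) [Field F] [Fintype F] (K L N P : ℕ) : ℝ≥0∞ :=
  ⨆ S : {S : Protocol F K L N P // S.IsCorrect ∧ S.IsPrivate}, S.1.rate

end InnerProductRetrieval

/-!
The proof has two halves. Put `T = K (K + 1) / 2` and `M = T / P`.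

*Upper bound on the rate.* By finite Fourier analysis the `T` inner products become independent and
uniform as `L → ∞` (`tendsto_entropy_innerProd`): the coordinates contribute independent identically
distributed summands, and no nontrivial additive character is constant on their values. For fixed
queries, let `Φ C` be the sum over the servers of the entropies of the answers given the inner
products in `C`. Decoding a request `R` shows `Φ C ≥ H(X_R | X_C) + Φ (C ∪ R) / N`
(`Protocol.le_totalCondEntropy`), where privacy permits the use of one `Φ` for all requests.
Iterating this along a partition into `M` requests bounds the download from below.

*Protocols.* The trivial protocol suffices if `N = 1` or `M = 1`. Otherwise each inner product is
regarded as a linear functional on `F'^m` for a field `F'`, and each server sends, for each set `A`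
of pairs, `α |A|` sums of one symbol from each message in `A`. The weights `α` solve the recursion
`IsWeight`, which says that for a request `R` each set `B` disjoint from `R` is the trace of `N`
times as many labels as it carries itself. Hence the undesired symbols can be arranged so that each
interfering sum is downloaded on its own from one of the `N` servers (`exists_alignment`).
After the interference is cancelled, there remain as many equations as desired unknowns, and with
generic coefficient vectors over a large field they are nonsingular (`exists_generic_vectors`, whose
matching comes from Hall's theorem). At each server the vectors of each message are linearly
independent, so a uniformly random automorphism of `F'^m` for each message makes the queries private
(`exists_protocol_of_isCode`). The recursion for `α` gives the number of labels
(`exists_codes`). Finally `F'` is chosen with `|F'|^m = q` when `q` is a suitable power, and as a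
prime field with `q ≤ |F'|^m ≤ 4^m q` in general.
-/

namespace InnerProductRetrieval

/-! ### Entropy of functions on a finite uniform space -/

section UniformEntropy

variable {Ω α β γ : Type*} [Fintype Ω]

open Classical in
/-- The fiber of `f` through `ω`. -/
noncomputable def fiberAt (f : Ω → α) (ω : Ω) : Finset Ω :=
  Finset.univ.filter fun ω' => f ω' = f ω

theorem mem_fiberAt {f : Ω → α} {ω ω' : Ω} : ω' ∈ fiberAt f ω ↔ f ω' = f ω := by
  simp [fiberAt]

theorem fiberAt_card_pos (f : Ω → α) (ω : Ω) : (0 : ℝ) < (fiberAt f ω).card := by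
  exact_mod_cast Finset.card_pos.2 ⟨ω, mem_fiberAt.2 rfl⟩

theorem fiberAt_congr {f : Ω → α} {ω ω' : Ω} (h : f ω' = f ω) : fiberAt f ω' = fiberAt f ω := by
  ext; simp [mem_fiberAt, h]

/-- The Shannon entropy of `f ω` for `ω` uniform in the finite type `Ω`, written as the mean over
`ω` of the surprisal `log (|Ω| / |fiber of f through ω|)`. -/
noncomputable def unifEntropy (f : Ω → α) : ℝ :=
  (∑ ω, Real.log (Fintype.card Ω / (fiberAt f ω).card)) / Fintype.card Ω

theorem unifEntropy_mono {f : Ω → α} {g : Ω → β} (h : ∀ ω ω', f ω = f ω' → g ω = g ω') :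
    unifEntropy g ≤ unifEntropy f := by
  unfold unifEntropy
  refine div_le_div_of_nonneg_right (Finset.sum_le_sum fun ω _ => ?_) (Nat.cast_nonneg _)
  have : (0 : ℝ) < Fintype.card Ω := by exact_mod_cast Fintype.card_pos_iff.2 ⟨ω⟩
  refine Real.log_le_log (div_pos this (fiberAt_card_pos _ _)) ?_
  refine div_le_div_of_nonneg_left this.le (fiberAt_card_pos _ _) ?_
  exact_mod_cast Finset.card_le_card fun x hx => mem_fiberAt.2 (h _ _ (mem_fiberAt.1 hx))

theorem unifEntropy_congr {f : Ω → α} {g : Ω → β} (h : ∀ ω ω', f ω = f ω' ↔ g ω = g ω') :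
    unifEntropy g = unifEntropy f :=
  le_antisymm (unifEntropy_mono fun _ _ => (h _ _).1) (unifEntropy_mono fun _ _ => (h _ _).2)

theorem unifEntropy_nonneg (f : Ω → α) : 0 ≤ unifEntropy f := by
  refine div_nonneg (Finset.sum_nonneg fun ω _ => Real.log_nonneg ?_) (Nat.cast_nonneg _)
  rw [one_le_div (fiberAt_card_pos _ _)]
  exact_mod_cast Finset.card_le_univ _

theorem unifEntropy_of_subsingleton [Subsingleton α] (f : Ω → α) : unifEntropy f = 0 := by
  unfold unifEntropy
  rw [Finset.sum_eq_zero, zero_div]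
  intro ω _
  have : fiberAt f ω = Finset.univ := by
    ext; simp [mem_fiberAt, eq_iff_true_of_subsingleton]
  rw [this, Finset.card_univ, div_self, Real.log_one]
  exact_mod_cast (Fintype.card_pos_iff.2 ⟨ω⟩).ne'

open Classical in
/-- The summand is the exponential of minus the conditional mutual information density of `f` and
`g` given `h` at `ω`, so its mean is at most `1`. -/
theorem sum_fiber_ratio_le (f : Ω → α) (g : Ω → β) (h : Ω → γ) :
    ∑ ω, ((fiberAt (fun ω => (f ω, h ω)) ω).card * (fiberAt (fun ω => (g ω, h ω)) ω).card : ℝ) /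
        ((fiberAt (fun ω => (f ω, g ω, h ω)) ω).card * (fiberAt h ω).card) ≤ Fintype.card Ω := by
  have key : ∀ ω, ((fiberAt (fun ω => (f ω, h ω)) ω).card *
        (fiberAt (fun ω => (g ω, h ω)) ω).card : ℝ) /
        ((fiberAt (fun ω => (f ω, g ω, h ω)) ω).card * (fiberAt h ω).card) =
      ∑ x, ∑ y, if (f x = f ω ∧ h x = h ω) ∧ (g y = g ω ∧ h y = h ω) then
        ((fiberAt (fun ω => (f ω, g ω, h ω)) ω).card * (fiberAt h ω).card : ℝ)⁻¹ else 0 := by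
    intro ω
    rw [div_eq_mul_inv, Finset.card_eq_sum_ones, Finset.card_eq_sum_ones]
    simp only [fiberAt, Finset.sum_filter, Prod.mk.injEq, Nat.cast_sum, Nat.cast_ite, Nat.cast_one,
      Nat.cast_zero]
    rw [Finset.sum_mul_sum, Finset.sum_mul]
    refine Finset.sum_congr rfl fun x _ => ?_
    rw [Finset.sum_mul]
    refine Finset.sum_congr rfl fun y _ => ?_
    split_ifs <;> simp_all
  have inner : ∀ x y, (∑ ω, if (f x = f ω ∧ h x = h ω) ∧ (g y = g ω ∧ h y = h ω) then
        ((fiberAt (fun ω => (f ω, g ω, h ω)) ω).card * (fiberAt h ω).card : ℝ)⁻¹ else 0) ≤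
      if h y = h x then ((fiberAt h x).card : ℝ)⁻¹ else 0 := by
    intro x y
    by_cases hxy : ∃ ω₀, (f x = f ω₀ ∧ h x = h ω₀) ∧ (g y = g ω₀ ∧ h y = h ω₀)
    · obtain ⟨ω₀, ⟨h1, h2⟩, h3, h4⟩ := hxy
      rw [if_pos (h4.trans h2.symm), ← Finset.sum_filter]
      have e1 : (Finset.univ.filter fun ω => (f x = f ω ∧ h x = h ω) ∧ (g y = g ω ∧ h y = h ω)) =
          fiberAt (fun ω => (f ω, g ω, h ω)) ω₀ := by
        ext ω
        simp only [Finset.mem_filter, Finset.mem_univ, true_and, mem_fiberAt, Prod.mk.injEq,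
          h1, h2, h3, h4]
        constructor
        · rintro ⟨⟨a, b⟩, c, _⟩; exact ⟨a.symm, c.symm, b.symm⟩
        · rintro ⟨a, b, c⟩; exact ⟨⟨a.symm, c.symm⟩, b.symm, c.symm⟩
      rw [e1]
      have e2 : ∀ ω ∈ fiberAt (fun ω => (f ω, g ω, h ω)) ω₀,
          ((fiberAt (fun ω => (f ω, g ω, h ω)) ω).card * (fiberAt h ω).card : ℝ)⁻¹ =
          ((fiberAt (fun ω => (f ω, g ω, h ω)) ω₀).card * (fiberAt h x).card : ℝ)⁻¹ := by
        intro ω hω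
        have hω' := mem_fiberAt.1 hω
        rw [fiberAt_congr hω', fiberAt_congr (f := h) (ω' := ω) (ω := x)]
        simp only [Prod.mk.injEq] at hω'
        rw [hω'.2.2, h2]
      rw [Finset.sum_congr rfl e2, Finset.sum_const, nsmul_eq_mul, mul_inv, ← mul_assoc,
        mul_inv_cancel₀ (fiberAt_card_pos _ _).ne', one_mul]
    · rw [Finset.sum_eq_zero]
      · split_ifs <;> positivity
      · intro ω _
        rw [if_neg fun hh => hxy ⟨ω, hh⟩]
  calc _ = ∑ x, ∑ y, ∑ ω, if (f x = f ω ∧ h x = h ω) ∧ (g y = g ω ∧ h y = h ω) then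
        ((fiberAt (fun ω => (f ω, g ω, h ω)) ω).card * (fiberAt h ω).card : ℝ)⁻¹ else 0 := by
        rw [Finset.sum_congr rfl fun ω _ => key ω, Finset.sum_comm]
        exact Finset.sum_congr rfl fun x _ => Finset.sum_comm
    _ ≤ ∑ x, ∑ y, if h y = h x then ((fiberAt h x).card : ℝ)⁻¹ else 0 :=
        Finset.sum_le_sum fun x _ => Finset.sum_le_sum fun y _ => inner x y
    _ = ∑ x : Ω, (1 : ℝ) := by
        refine Finset.sum_congr rfl fun x _ => ?_
        rw [← Finset.sum_filter, Finset.sum_const, nsmul_eq_mul]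
        exact mul_inv_cancel₀ (fiberAt_card_pos h x).ne'
    _ = _ := by simp

/-- Submodularity of entropy (nonnegativity of conditional mutual information). -/
theorem unifEntropy_submodular (f : Ω → α) (g : Ω → β) (h : Ω → γ) :
    unifEntropy (fun ω => (f ω, g ω, h ω)) + unifEntropy h ≤
      unifEntropy (fun ω => (f ω, h ω)) + unifEntropy (fun ω => (g ω, h ω)) := by
  rcases isEmpty_or_nonempty Ω with hΩ | hΩ
  · simp [unifEntropy]
  have hc : (0 : ℝ) < Fintype.card Ω := by exact_mod_cast Fintype.card_pos
  unfold unifEntropy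
  rw [← add_div, ← add_div]
  refine div_le_div_of_nonneg_right ?_ hc.le
  rw [← sub_nonpos, ← Finset.sum_add_distrib, ← Finset.sum_add_distrib, ← Finset.sum_sub_distrib]
  have hterm : ∀ ω, (Real.log (Fintype.card Ω / (fiberAt (fun ω => (f ω, g ω, h ω)) ω).card) +
      Real.log (Fintype.card Ω / (fiberAt h ω).card)) -
      (Real.log (Fintype.card Ω / (fiberAt (fun ω => (f ω, h ω)) ω).card) +
      Real.log (Fintype.card Ω / (fiberAt (fun ω => (g ω, h ω)) ω).card)) ≤
      ((fiberAt (fun ω => (f ω, h ω)) ω).card * (fiberAt (fun ω => (g ω, h ω)) ω).card : ℝ) /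
        ((fiberAt (fun ω => (f ω, g ω, h ω)) ω).card * (fiberAt h ω).card) - 1 := by
    intro ω
    have p1 := fiberAt_card_pos (fun ω => (f ω, g ω, h ω)) ω
    have p2 := fiberAt_card_pos h ω
    have p3 := fiberAt_card_pos (fun ω => (f ω, h ω)) ω
    have p4 := fiberAt_card_pos (fun ω => (g ω, h ω)) ω
    refine le_trans (le_of_eq ?_) (Real.log_le_sub_one_of_pos (by positivity))
    rw [Real.log_div hc.ne' p1.ne', Real.log_div hc.ne' p2.ne', Real.log_div hc.ne' p3.ne',
      Real.log_div hc.ne' p4.ne', Real.log_div (by positivity) (by positivity),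
      Real.log_mul p3.ne' p4.ne', Real.log_mul p1.ne' p2.ne']
    ring
  refine (Finset.sum_le_sum fun ω _ => hterm ω).trans ?_
  rw [Finset.sum_sub_distrib, sub_nonpos]
  simpa using sum_fiber_ratio_le f g h

/-- Conditional subadditivity of entropy for a finite family. -/
theorem unifEntropy_pi_le {ι : Type*} [Fintype ι] (f : ι → Ω → α) (h : Ω → γ) :
    unifEntropy (fun ω => (fun i => f i ω, h ω)) - unifEntropy h ≤
      ∑ i, (unifEntropy (fun ω => (f i ω, h ω)) - unifEntropy h) := by
  classical
  have key : ∀ s : Finset ι, unifEntropy (fun ω => (fun i : s => f i ω, h ω)) - unifEntropy h ≤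
      ∑ i ∈ s, (unifEntropy (fun ω => (f i ω, h ω)) - unifEntropy h) := by
    intro s
    induction s using Finset.induction_on with
    | empty =>
      rw [Finset.sum_empty, sub_nonpos]
      exact unifEntropy_mono fun ω ω' e => by
        simp only [Prod.mk.injEq, e, and_true]; funext i; exact absurd i.2 (Finset.notMem_empty _)
    | insert a s ha ih =>
      rw [Finset.sum_insert ha]
      have h1 := unifEntropy_submodular (f a) (fun ω => fun i : s => f i ω) h
      have h2 : unifEntropy (fun ω => (fun i : (insert a s : Finset ι) => f i ω, h ω)) ≤
          unifEntropy (fun ω => (f a ω, (fun i : s => f i ω), h ω)) := by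
        refine unifEntropy_mono fun ω ω' e => ?_
        simp only [Prod.mk.injEq] at e ⊢
        refine ⟨funext fun i => ?_, e.2.2⟩
        rcases Finset.mem_insert.1 i.2 with hi | hi
        · rw [hi]; exact e.1
        · exact congrFun e.2.1 ⟨i, hi⟩
      linarith
  refine le_trans ?_ (key Finset.univ)
  refine sub_le_sub_right (unifEntropy_mono fun ω ω' e => ?_) _
  simp only [Prod.mk.injEq] at e ⊢
  exact ⟨funext fun i => congrFun e.1 ⟨i, Finset.mem_univ i⟩, e.2⟩

open Classical in
theorem map_uniform_apply [Nonempty Ω] (f : Ω → α) (a : α) :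
    (((PMF.uniformOfFintype Ω).map f) a).toReal =
      ((Finset.univ.filter fun ω => f ω = a).card : ℝ) / Fintype.card Ω := by
  rw [PMF.map_apply, tsum_fintype]
  simp only [PMF.uniformOfFintype_apply]
  rw [← Finset.sum_filter, Finset.sum_const, nsmul_eq_mul, ENNReal.toReal_mul,
    ENNReal.toReal_natCast, ENNReal.toReal_inv, ENNReal.toReal_natCast, div_eq_mul_inv]
  congr 3
  ext ω
  simp [eq_comm]

theorem entropy_map_uniform [Nonempty Ω] (f : Ω → α) :
    entropy ((PMF.uniformOfFintype Ω).map f) = ENNReal.ofReal (unifEntropy f) := by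
  classical
  have hc : (0 : ℝ) < Fintype.card Ω := by exact_mod_cast Fintype.card_pos
  unfold entropy
  rw [tsum_eq_sum (s := Finset.univ.image f), ← ENNReal.ofReal_sum_of_nonneg]
  · congr 1
    unfold unifEntropy
    have := Finset.sum_comp (s := (Finset.univ : Finset Ω)) (fun a : α =>
      Real.log (Fintype.card Ω / ((Finset.univ.filter fun ω => f ω = a).card : ℝ))) f
    have e : ∀ ω, fiberAt f ω = Finset.univ.filter fun ω' => f ω' = f ω := fun ω => by
      ext; simp [mem_fiberAt]
    simp only [e]
    rw [this, Finset.sum_div]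
    refine Finset.sum_congr rfl fun a _ => ?_
    have hlog : ∀ x y : ℝ, Real.negMulLog (x / y) = x * Real.log (y / x) / y := fun x y => by
      rw [Real.negMulLog, ← inv_div x y, Real.log_inv]
      ring
    rw [map_uniform_apply, hlog, nsmul_eq_mul]
  · intro a _
    rw [map_uniform_apply]
    refine Real.negMulLog_nonneg (by positivity) ?_
    rw [div_le_one hc]
    exact_mod_cast Finset.card_le_univ _
  · intro a ha
    rw [map_uniform_apply, Finset.filter_false_of_mem]
    · simp
    · intro ω _ hω
      exact ha (Finset.mem_image.2 ⟨ω, Finset.mem_univ _, hω⟩)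

end UniformEntropy

/-! ### Entropy of discrete laws -/

section DiscreteEntropy

variable {ι α : Type*}

theorem toReal_apply_le_one (p : PMF α) (a : α) : (p a).toReal ≤ 1 := by
  simpa using ENNReal.toReal_mono ENNReal.one_ne_top (p.coe_le_one a)

theorem tsum_map_mul (p : PMF ι) (f : ι → α) (g : α → ℝ≥0∞) :
    ∑' a, (p.map f) a * g a = ∑' i, p i * g (f i) := by
  classical
  simp only [PMF.map_apply, ← ENNReal.tsum_mul_right]
  rw [ENNReal.tsum_comm]
  refine tsum_congr fun i => ?_
  rw [tsum_eq_single (f i)]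
  · simp
  · intro a ha
    rw [if_neg ha, zero_mul]

/-- The tangent line of `x ↦ -x log x` at `x` lies above its graph, stated without subtraction. -/
theorem negMulLog_tangent {p x : ℝ} (hp : 0 ≤ p) (hx : 0 < x) :
    Real.negMulLog p + p ≤ p * (-Real.log x) + x := by
  rcases hp.eq_or_lt with rfl | hp
  · simpa using hx.le
  · have := Real.log_le_sub_one_of_pos (div_pos hx hp)
    rw [Real.log_div hx.ne' hp.ne'] at this
    have h2 := mul_le_mul_of_nonneg_left this hp.le
    rw [mul_sub, mul_sub, mul_div_cancel₀ _ hp.ne'] at h2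
    unfold Real.negMulLog
    linarith

/-- Entropy is concave: a mixture has at least the mean entropy of its components. -/
theorem tsum_mul_entropy_le (μ : PMF ι) (κ : ι → PMF α) :
    ∑' k, μ k * entropy (κ k) ≤ entropy (μ.bind κ) := by
  unfold entropy
  simp only [← ENNReal.tsum_mul_left]
  rw [ENNReal.tsum_comm]
  refine ENNReal.tsum_le_tsum fun a => ?_
  set x := (μ.bind κ) a with hx
  have hsum : ∑' k, μ k * κ k a = x := by rw [hx, PMF.bind_apply]
  have hxt : x ≠ ∞ := PMF.apply_ne_top _ _
  by_cases hx0 : x = 0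
  · have : ∀ k, μ k * κ k a = 0 := ENNReal.tsum_eq_zero.1 (hsum.trans hx0)
    rw [ENNReal.tsum_eq_zero.2]
    · exact zero_le
    · intro k
      rcases mul_eq_zero.1 (this k) with h | h
      · rw [h, zero_mul]
      · simp [h]
  have hxpos : 0 < x.toReal := ENNReal.toReal_pos hx0 hxt
  have hlog : 0 ≤ -Real.log x.toReal :=
    neg_nonneg.2 (Real.log_nonpos hxpos.le (toReal_apply_le_one _ _))
  have hk : ∀ k, μ k * ENNReal.ofReal (Real.negMulLog (κ k a).toReal) + μ k * κ k a ≤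
      μ k * κ k a * ENNReal.ofReal (-Real.log x.toReal) + μ k * x := by
    intro k
    rw [← mul_add, mul_assoc, ← mul_add]
    refine mul_le_mul_right ?_ _
    have h0 := Real.negMulLog_nonneg ENNReal.toReal_nonneg (toReal_apply_le_one (κ k) a)
    conv_lhs => rw [← ENNReal.ofReal_toReal (PMF.apply_ne_top (κ k) a)]
    conv_rhs => rw [← ENNReal.ofReal_toReal (PMF.apply_ne_top (κ k) a), ← ENNReal.ofReal_toReal hxt]
    rw [ENNReal.toReal_ofReal ENNReal.toReal_nonneg, ENNReal.toReal_ofReal ENNReal.toReal_nonneg,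
      ← ENNReal.ofReal_mul ENNReal.toReal_nonneg, ← ENNReal.ofReal_add h0 ENNReal.toReal_nonneg,
      ← ENNReal.ofReal_add (mul_nonneg ENNReal.toReal_nonneg hlog) ENNReal.toReal_nonneg]
    exact ENNReal.ofReal_le_ofReal (negMulLog_tangent ENNReal.toReal_nonneg hxpos)
  have hs := ENNReal.tsum_le_tsum hk
  rw [ENNReal.tsum_add, ENNReal.tsum_add, ENNReal.tsum_mul_right, ENNReal.tsum_mul_right,
    μ.tsum_coe, hsum, one_mul] at hs
  have := ENNReal.le_of_add_le_add_right hxt hs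
  refine this.trans (le_of_eq ?_)
  conv_lhs => rw [← ENNReal.ofReal_toReal hxt]
  rw [ENNReal.toReal_ofReal ENNReal.toReal_nonneg, ← ENNReal.ofReal_mul ENNReal.toReal_nonneg]
  congr 1
  unfold Real.negMulLog
  ring

/-- A law carried by a finite set `s` has entropy at most `log |s|`. -/
theorem entropy_le_log_card (p : PMF α) (s : Finset α) (hs : ∀ a, a ∉ s → p a = 0) :
    entropy p ≤ ENNReal.ofReal (Real.log s.card) := by
  have hsum : ∑ a ∈ s, (p a).toReal = 1 := by
    rw [← ENNReal.toReal_sum fun a _ => p.apply_ne_top a,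
      ← tsum_eq_sum (f := fun a => p a) (L := SummationFilter.unconditional _) (fun a => hs a),
      p.tsum_coe,
      ENNReal.toReal_one]
  have hne : s.Nonempty := by
    rw [Finset.nonempty_iff_ne_empty]
    rintro rfl
    simp at hsum
  have hc : (0 : ℝ) < s.card := by exact_mod_cast Finset.card_pos.2 hne
  unfold entropy
  rw [tsum_eq_sum (s := s) fun a ha => by simp [hs a ha], ← ENNReal.ofReal_sum_of_nonneg
    fun a _ => Real.negMulLog_nonneg ENNReal.toReal_nonneg (toReal_apply_le_one p a)]
  refine ENNReal.ofReal_le_ofReal ?_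
  have := Finset.sum_le_sum fun a (_ : a ∈ s) =>
    negMulLog_tangent (ENNReal.toReal_nonneg (a := p a)) (inv_pos.2 hc)
  rw [Finset.sum_add_distrib, Finset.sum_add_distrib, ← Finset.sum_mul, hsum, Finset.sum_const,
    nsmul_eq_mul, mul_inv_cancel₀ hc.ne', Real.log_inv, neg_neg, one_mul] at this
  linarith

end DiscreteEntropy

/-! ### The inner products are asymptotically uniform -/

section AsymptoticLaw

variable {F : Type*} [Field F] {K : ℕ}

/-- The contribution of one coordinate `w` of the files to the inner products. -/
def pairProd (w : Fin K → F) : Sym2 (Fin K) → F :=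
  Sym2.lift ⟨fun i j => w i * w j, fun _ _ => mul_comm _ _⟩

theorem pairProd_mk (w : Fin K → F) (i j : Fin K) : pairProd w s(i, j) = w i * w j := rfl

theorem addChar_map_sum {G ι : Type*} [AddCommGroup G] (χ : AddChar G ℂ) (S : Finset ι)
    (f : ι → G) : χ (∑ i ∈ S, f i) = ∏ i ∈ S, χ (f i) := by
  classical
  induction S using Finset.induction_on with
  | empty => simp
  | insert a S ha ih => rw [Finset.sum_insert ha, Finset.prod_insert ha, χ.map_add_eq_mul, ih]

theorem innerProd_eq_sum {L : ℕ} (W : Files F K L) :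
    innerProd W = ∑ l, pairProd fun i => W i l := by
  funext t
  induction t using Sym2.ind with
  | _ i j => simp [innerProd, pairProd, Finset.sum_apply]

theorem addChar_eq_one_of_sq [Finite F] (χ : AddChar F ℂ) (h : ∀ a, χ (a ^ 2) = 1) (x : F) : χ x = 1 := by
  -- `x` is a square in characteristic two, and a difference of squares otherwise
  by_cases h2 : ringChar F = 2
  · obtain ⟨a, ha⟩ := FiniteField.isSquare_of_char_two h2 x
    rw [ha, ← sq, h]
  · have h2' : (2 : F) ≠ 0 := Ring.two_ne_zero h2
    have : x + ((x - 1) / 2) ^ 2 = ((x + 1) / 2) ^ 2 := by field_simp; ring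
    have e := congrArg χ this
    rwa [AddChar.map_add_eq_mul, h, h, mul_one] at e

/-- The values of `pairProd` lie in the kernel of no nontrivial additive character. -/
theorem addChar_eq_one_of_pairProd [Finite F] (χ : AddChar (Sym2 (Fin K) → F) ℂ)
    (h : ∀ w, χ (pairProd w) = 1) (x : Sym2 (Fin K) → F) : χ x = 1 := by
  classical
  have hsum : ∀ y : Sym2 (Fin K) → F, χ y = ∏ t, χ (Pi.single t (y t)) := by
    intro y
    conv_lhs => rw [← Finset.univ_sum_single y]
    exact addChar_map_sum χ Finset.univ fun t => Pi.single t (y t)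
  have hsupp : ∀ (w : Fin K → F) (S : Finset (Sym2 (Fin K))),
      (∀ t, t ∉ S → pairProd w t = 0) → ∏ t ∈ S, χ (Pi.single t (pairProd w t)) = 1 := by
    intro w S hS
    rw [← h w, hsum (pairProd w)]
    refine Finset.prod_subset (Finset.subset_univ _) fun t _ ht => ?_
    rw [hS t ht, Pi.single_zero, AddChar.map_zero_eq_one]
  have hdiag : ∀ i (a : F), χ (Pi.single s(i, i) a) = 1 := by
    intro i
    have hsq : ∀ a : F, χ (Pi.single s(i, i) (a ^ 2)) = 1 := by
      intro a
      have := hsupp (Pi.single i a) {s(i, i)} fun t ht => by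
        induction t using Sym2.ind with
        | _ k l =>
          rw [pairProd_mk]
          by_cases hk : k = i
          · by_cases hl : l = i
            · subst hk hl; simp at ht
            · simp [hl]
          · simp [hk]
      simpa [pairProd_mk, sq] using this
    exact addChar_eq_one_of_sq
      (χ.compAddMonoidHom (AddMonoidHom.single (fun _ : Sym2 (Fin K) => F) s(i, i))) hsq
  have hoff : ∀ i j, i ≠ j → ∀ a : F, χ (Pi.single s(i, j) a) = 1 := by
    intro i j hij a
    have hw : ∀ k, (Pi.single i a + Pi.single j 1 : Fin K → F) k ≠ 0 → k = i ∨ k = j := by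
      intro k hk
      by_contra! hc
      exact hk (by simp [hc.1, hc.2])
    have := hsupp (Pi.single i a + Pi.single j 1) {s(i, j), s(i, i), s(j, j)} fun t ht => by
      induction t using Sym2.ind with
      | _ k l =>
        by_contra hne
        rw [pairProd_mk] at hne
        refine ht ?_
        rcases hw k (left_ne_zero_of_mul hne) with rfl | rfl <;>
          rcases hw l (right_ne_zero_of_mul hne) with rfl | rfl <;>
            simp [Sym2.eq_swap]
    rw [Finset.prod_insert (by simp [hij, hij.symm]),
      Finset.prod_insert (by simp [hij]), Finset.prod_singleton, hdiag, hdiag,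
      mul_one, mul_one, pairProd_mk] at this
    simpa [hij, hij.symm] using this
  rw [hsum x]
  refine Finset.prod_eq_one fun t _ => ?_
  induction t using Sym2.ind with
  | _ i j =>
    by_cases hij : i = j
    · subst hij; exact hdiag i _
    · exact hoff i j hij _

theorem norm_sum_lt_card {ι : Type*} [Fintype ι] (z : ι → ℂ) (hz : ∀ i, ‖z i‖ = 1) {i j : ι}
    (hij : z i ≠ z j) : ‖∑ k, z k‖ < Fintype.card ι := by
  classical
  have hne : i ≠ j := fun h => hij (by rw [h])
  have h1 : ‖z i + z j‖ < 2 := by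
    have := norm_add_lt_of_not_sameRay (x := z i) (y := z j)
      (by rwa [sameRay_iff_of_norm_eq (by rw [hz, hz])])
    rwa [hz, hz, one_add_one_eq_two] at this
  have hj : j ∈ Finset.univ.erase i := by simp [hne.symm]
  rw [← Finset.add_sum_erase _ _ (Finset.mem_univ i), ← Finset.add_sum_erase _ _ hj, ← add_assoc]
  have h2 : ‖∑ k ∈ (Finset.univ.erase i).erase j, z k‖ ≤
      ((Finset.univ.erase i).erase j).card := by
    refine (norm_sum_le _ _).trans (le_of_eq ?_)
    simp [hz]
  have h3 : (((Finset.univ.erase i).erase j).card : ℝ) + 2 = Fintype.card ι := by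
    have := Finset.card_erase_add_one hj
    have h' := Finset.card_erase_add_one (Finset.mem_univ i)
    rw [Finset.card_univ] at h'
    exact_mod_cast (by omega : ((Finset.univ.erase i).erase j).card + 2 = Fintype.card ι)
  calc _ ≤ ‖z i + z j‖ + ‖∑ k ∈ (Finset.univ.erase i).erase j, z k‖ := norm_add_le _ _
    _ < _ := by linarith

/-- The character sum of the inner products over all files factors over the coordinates. -/
theorem sum_addChar_innerProd [Fintype F] (L : ℕ) (s : Finset (Sym2 (Fin K))) (χ : AddChar (s → F) ℂ) :
    ∑ W : Files F K L, χ (fun t => innerProd W t) =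
      (∑ w : Fin K → F, χ (fun t => pairProd w t)) ^ L := by
  classical
  have := Fintype.sum_pow (fun w : Fin K → F => χ (fun t : s => pairProd w t)) L
  rw [this]
  refine Fintype.sum_equiv (Equiv.piComm fun _ _ => F) _ _ fun W => ?_
  rw [← addChar_map_sum]
  congr 1
  funext t
  rw [innerProd_eq_sum, Finset.sum_apply, Finset.sum_apply]
  rfl

open Classical in
/-- Each value of a family of inner products has asymptotically the uniform probability. -/
theorem tendsto_prob_innerProd [Fintype F] (s : Finset (Sym2 (Fin K))) (x : s → F) :
    Tendsto (fun L : ℕ => ((Finset.univ.filter fun W : Files F K L =>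
      (fun t : s => innerProd W t) = x).card : ℝ) / Fintype.card (Files F K L)) atTop
      (𝓝 (1 / Fintype.card (s → F))) := by
  have hq : (Fintype.card (Fin K → F) : ℂ) ≠ 0 := by exact_mod_cast Fintype.card_ne_zero
  have hG : (Fintype.card (s → F) : ℂ) ≠ 0 := by exact_mod_cast Fintype.card_ne_zero
  have hcard : ∀ L, Fintype.card (Files F K L) = Fintype.card (Fin K → F) ^ L := by
    intro L
    simp [Files, ← pow_mul, mul_comm]
  have hcount : ∀ L : ℕ, (((Finset.univ.filter fun W : Files F K L =>
      (fun t : s => innerProd W t) = x).card : ℂ)) / Fintype.card (Files F K L) =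
      (Fintype.card (s → F) : ℂ)⁻¹ * ∑ χ : AddChar (s → F) ℂ, χ (-x) *
        ((∑ w : Fin K → F, χ (fun t => pairProd w t)) / Fintype.card (Fin K → F)) ^ L := by
    intro L
    have h1 : ∑ χ : AddChar (s → F) ℂ, χ (-x) * ∑ W : Files F K L, χ (fun t => innerProd W t) =
        Fintype.card (s → F) * ((Finset.univ.filter fun W : Files F K L =>
          (fun t : s => innerProd W t) = x).card : ℂ) := by
      simp only [Finset.mul_sum, ← AddChar.map_add_eq_mul]
      rw [Finset.sum_comm]
      simp only [AddChar.sum_apply_eq_ite]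
      rw [← Finset.sum_filter, Finset.sum_const, nsmul_eq_mul, mul_comm]
      congr 4
      ext W
      rw [neg_add_eq_zero, eq_comm]
    simp only [sum_addChar_innerProd] at h1
    simp only [div_pow, mul_div_assoc', ← Finset.sum_div]
    rw [h1, hcard, Nat.cast_pow]
    field_simp
  have hlim : ∀ χ : AddChar (s → F) ℂ, Tendsto (fun L : ℕ => χ (-x) *
        ((∑ w : Fin K → F, χ (fun t => pairProd w t)) / Fintype.card (Fin K → F)) ^ L) atTop
        (𝓝 (if χ = 0 then 1 else 0)) := by
    intro χ
    split_ifs with hχ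
    · subst hχ
      simp only [AddChar.zero_apply, Finset.sum_const, Finset.card_univ, nsmul_eq_mul, mul_one]
      rw [div_self hq]
      simp
    · rw [← mul_zero (χ (-x))]
      refine Tendsto.const_mul _ (tendsto_pow_atTop_nhds_zero_of_norm_lt_one ?_)
      obtain ⟨w, hw⟩ : ∃ w : Fin K → F, χ (fun t => pairProd w t) ≠ 1 := by
        by_contra! hall
        refine hχ (DFunLike.ext _ _ fun y => ?_)
        let r : (Sym2 (Fin K) → F) →+ (s → F) :=
          { toFun := fun z t => z t, map_zero' := rfl, map_add' := fun _ _ => rfl }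
        have := addChar_eq_one_of_pairProd (χ.compAddMonoidHom r) hall
          (fun t => if h : t ∈ s then y ⟨t, h⟩ else 0)
        rw [AddChar.zero_apply, ← this]
        simp [r, AddChar.compAddMonoidHom_apply]
      have h0 : χ (fun t => pairProd (0 : Fin K → F) t) = 1 := by
        rw [← AddChar.map_zero_eq_one χ]
        congr 1
        funext t
        obtain ⟨t, ht⟩ := t
        induction t using Sym2.ind with
        | _ i j => simp [pairProd_mk]
      rw [norm_div, Complex.norm_natCast, div_lt_one (by exact_mod_cast Fintype.card_pos)]
      exact norm_sum_lt_card _ (fun w => AddChar.norm_apply _ _) (i := w) (j := 0) (by rwa [h0])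
  have htot := (tendsto_finsetSum Finset.univ fun χ _ => hlim χ).const_mul
    (Fintype.card (s → F) : ℂ)⁻¹
  rw [Finset.sum_ite_eq' Finset.univ, if_pos (Finset.mem_univ _), mul_one] at htot
  have hre := (Complex.continuous_re.tendsto _).comp htot
  refine Tendsto.congr (fun L => ?_) (hre.trans (le_of_eq ?_))
  · rw [Function.comp_apply, ← hcount]
    norm_cast
  · congr 1
    rw [one_div, ← Complex.ofReal_natCast, ← Complex.ofReal_inv, Complex.ofReal_re]

/-- The entropy of a family of inner products tends to that of uniformly distributed symbols. -/
theorem tendsto_entropy_innerProd [Fintype F] (s : Finset (Sym2 (Fin K))) :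
    Tendsto (fun L : ℕ => unifEntropy fun (W : Files F K L) (t : s) => innerProd W t) atTop
      (𝓝 (s.card * Real.log (Fintype.card F))) := by
  classical
  have hval : ∀ L : ℕ, unifEntropy (fun (W : Files F K L) (t : s) => innerProd W t) =
      ∑ x : s → F, Real.negMulLog (((Finset.univ.filter fun W : Files F K L =>
      (fun t : s => innerProd W t) = x).card : ℝ) / Fintype.card (Files F K L)) := by
    intro L
    have h := entropy_map_uniform fun (W : Files F K L) (t : s) => innerProd W t
    unfold entropy at h
    rw [tsum_fintype, ← ENNReal.ofReal_sum_of_nonneg fun a _ =>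
      Real.negMulLog_nonneg ENNReal.toReal_nonneg (toReal_apply_le_one _ a)] at h
    have h' := (ENNReal.ofReal_eq_ofReal_iff (Finset.sum_nonneg fun a _ =>
      Real.negMulLog_nonneg ENNReal.toReal_nonneg (toReal_apply_le_one _ a))
      (unifEntropy_nonneg _)).1 h
    rw [← h']
    refine Finset.sum_congr rfl fun x _ => ?_
    rw [map_uniform_apply]
    congr!
  have hlim := tendsto_finsetSum (Finset.univ : Finset (s → F)) fun x _ =>
    (Real.continuous_negMulLog.tendsto _).comp (tendsto_prob_innerProd s x)
  refine Tendsto.congr (fun L => (hval L).symm) (hlim.trans (le_of_eq ?_))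
  congr 1
  have hG : (Fintype.card (s → F) : ℝ) ≠ 0 := by exact_mod_cast Fintype.card_ne_zero
  rw [Finset.sum_const, Finset.card_univ, nsmul_eq_mul, Real.negMulLog, one_div, Real.log_inv]
  rw [neg_mul_neg, ← mul_assoc, mul_inv_cancel₀ hG, one_mul, Fintype.card_fun, Nat.cast_pow,
    Real.log_pow, Fintype.card_coe]

end AsymptoticLaw

/-! ### Upper bound on the rate of a protocol -/

section Converse

variable {F : Type*} [Field F] [Fintype F] {K L N P : ℕ}

/-- The inner products indexed by a finite set of pairs. -/
def innerProds (L : ℕ) (C : Finset (Sym2 (Fin K))) (W : Files F K L) (t : C) : F :=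
  innerProd W t

namespace Protocol

variable (S : Protocol F K L N P)

/-- The law of the query to server `n`. -/
noncomputable def queryLawAt (R : Request K P) (n : Fin N) : PMF ℕ :=
  (S.queryLaw R).map fun q => q n

theorem queryLawAt_eq (hS : S.IsPrivate) (R₁ R₂ : Request K P) (n : Fin N) :
    S.queryLawAt R₁ n = S.queryLawAt R₂ n := by
  have key : ∀ R, (S.serverLaw R n).map (fun x => x.1) = S.queryLawAt R n := by
    intro R
    unfold serverLaw law queryLawAt
    rw [PMF.map_comp, PMF.map_bind]
    simp only [PMF.map_comp, Function.comp_def]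
    exact congrArg _ (funext fun q => PMF.map_const _ _)
  rw [← key, ← key, hS R₁ R₂ n]

theorem answerLaw_eq (R : Request K P) (n : Fin N) :
    S.answerLaw R n = (S.queryLawAt R n).bind fun k => (filesLaw F K L).map (S.answer n k) := by
  unfold answerLaw law queryLawAt
  rw [PMF.map_bind, PMF.bind_map]
  simp only [PMF.map_comp, Function.comp_def]

theorem mem_support_law (R : Request K P) {q : Fin N → ℕ} (hq : q ∈ (S.queryLaw R).support)
    (W : Files F K L) : (q, W) ∈ (S.law R).support := by
  rw [law, PMF.mem_support_bind_iff]
  refine ⟨q, hq, ?_⟩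
  rw [PMF.mem_support_map_iff]
  exact ⟨W, by simp [filesLaw], rfl⟩

/-- The entropy of the answer of server `n` to the query `k`, given the inner products in `C`. -/
noncomputable def condEntropy (n : Fin N) (k : ℕ) (C : Finset (Sym2 (Fin K))) : ℝ :=
  unifEntropy (fun W => (S.answer n k W, innerProds L C W)) - unifEntropy (innerProds (F := F) L C)

theorem condEntropy_nonneg (n : Fin N) (k : ℕ) (C : Finset (Sym2 (Fin K))) :
    0 ≤ S.condEntropy n k C :=
  sub_nonneg.2 (unifEntropy_mono fun _ _ h => (Prod.mk.inj h).2)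

/-- The total entropy of the answers, given the queries and the inner products in `C`. -/
noncomputable def totalCondEntropy (R : Request K P) (C : Finset (Sym2 (Fin K))) : ℝ≥0∞ :=
  ∑ n, ∑' k, S.queryLawAt R n k * ENNReal.ofReal (S.condEntropy n k C)

theorem totalCondEntropy_eq_tsum (R : Request K P) (C : Finset (Sym2 (Fin K))) :
    S.totalCondEntropy R C =
      ∑' q, S.queryLaw R q * ENNReal.ofReal (∑ n, S.condEntropy n (q n) C) := by
  unfold totalCondEntropy queryLawAt
  simp only [tsum_map_mul]
  rw [← Summable.tsum_finsetSum fun _ _ => ENNReal.summable]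
  refine tsum_congr fun q => ?_
  rw [← Finset.mul_sum, ENNReal.ofReal_sum_of_nonneg fun n _ => S.condEntropy_nonneg n _ C]

/-- For fixed queries that allow decoding of `R`, the answers reveal the inner products in `R`,
and beyond those at least as much as each single answer does. -/
theorem le_sum_condEntropy (hS : S.IsCorrect) (R : Request K P) {q : Fin N → ℕ}
    (hq : q ∈ (S.queryLaw R).support) (C : Finset (Sym2 (Fin K))) :
    unifEntropy (innerProds (F := F) L (C ∪ R.1)) - unifEntropy (innerProds (F := F) L C) +
      (1 / N : ℝ) * ∑ n, S.condEntropy n (q n) (C ∪ R.1) ≤ ∑ n, S.condEntropy n (q n) C := by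
  classical
  have h1 := unifEntropy_pi_le (fun n => S.answer n (q n)) (innerProds (F := F) L C)
  obtain ⟨decode, hdec⟩ := hS R
  have hdet : ∀ W W' : Files F K L, (fun n => S.answer n (q n) W) = (fun n => S.answer n (q n) W') →
      innerProds L C W = innerProds L C W' →
      innerProds L (C ∪ R.1) W = innerProds L (C ∪ R.1) W' := by
    refine fun W W' e1 e2 => funext fun t => ?_
    rcases Finset.mem_union.1 t.2 with ht | ht
    · exact congrFun e2 ⟨t, ht⟩
    · have hW := hdec (q, W) (S.mem_support_law R hq W)
      have hW' := hdec (q, W') (S.mem_support_law R hq W')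
      have e' : S.answers q W = S.answers q W' := e1
      simp only [e'] at hW hW'
      exact congrFun (hW.symm.trans hW') ⟨t, ht⟩
  have h2 : ∀ n, unifEntropy (fun W => (S.answer n (q n) W, innerProds L (C ∪ R.1) W)) ≤
      unifEntropy (fun W => (fun n => S.answer n (q n) W, innerProds (F := F) L C W)) := by
    intro n
    refine unifEntropy_mono fun W W' e => ?_
    simp only [Prod.mk.injEq] at e ⊢
    exact ⟨congrFun e.1 n, hdet W W' e.1 e.2⟩
  have h0 : unifEntropy (innerProds (F := F) L (C ∪ R.1)) ≤
      unifEntropy (fun W => (fun n => S.answer n (q n) W, innerProds (F := F) L C W)) :=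
    unifEntropy_mono fun W W' e => hdet W W' (Prod.mk.inj e).1 (Prod.mk.inj e).2
  have h3 : (1 / N : ℝ) * ∑ n, S.condEntropy n (q n) (C ∪ R.1) ≤
      unifEntropy (fun W => (fun n => S.answer n (q n) W, innerProds (F := F) L C W)) -
        unifEntropy (innerProds (F := F) L (C ∪ R.1)) := by
    have := Finset.sum_le_sum fun n (_ : n ∈ Finset.univ) =>
      sub_le_sub_right (h2 n) (unifEntropy (innerProds (F := F) L (C ∪ R.1)))
    rw [Finset.sum_const, Finset.card_univ, Fintype.card_fin, nsmul_eq_mul] at this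
    rcases Nat.eq_zero_or_pos N with hN | hN
    · subst hN
      simpa using h0
    · have hN' : (0 : ℝ) < N := by exact_mod_cast hN
      rw [one_div, inv_mul_le_iff₀ hN']
      exact this
  have h4 : ∑ n, S.condEntropy n (q n) C = ∑ n, (unifEntropy (fun W =>
    (S.answer n (q n) W, innerProds (F := F) L C W)) - unifEntropy (innerProds (F := F) L C)) := rfl
  linarith

theorem le_totalCondEntropy (hS : S.IsCorrect) (hP : S.IsPrivate) (hN : 1 ≤ N)
    (R₀ R : Request K P) (C : Finset (Sym2 (Fin K))) :
    ENNReal.ofReal (unifEntropy (innerProds (F := F) L (C ∪ R.1)) -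
      unifEntropy (innerProds (F := F) L C)) +
      1 / (N : ℝ≥0∞) * S.totalCondEntropy R₀ (C ∪ R.1) ≤ S.totalCondEntropy R₀ C := by
  have hR : ∀ C, S.totalCondEntropy R₀ C = S.totalCondEntropy R C := fun C => by
    unfold totalCondEntropy
    simp only [S.queryLawAt_eq hP R₀ R]
  have hN' : (0 : ℝ) < N := by exact_mod_cast hN
  have hmono : 0 ≤ unifEntropy (innerProds (F := F) L (C ∪ R.1)) -
      unifEntropy (innerProds (F := F) L C) := by
    refine sub_nonneg.2 (unifEntropy_mono fun W W' e => funext fun t => ?_)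
    exact congrFun e ⟨t, Finset.mem_union_left _ t.2⟩
  rw [hR, hR, totalCondEntropy_eq_tsum, totalCondEntropy_eq_tsum]
  have h1 : ENNReal.ofReal (unifEntropy (innerProds (F := F) L (C ∪ R.1)) -
      unifEntropy (innerProds (F := F) L C)) = ∑' q, S.queryLaw R q * ENNReal.ofReal
        (unifEntropy (innerProds (F := F) L (C ∪ R.1)) -
        unifEntropy (innerProds (F := F) L C)) := by
    rw [ENNReal.tsum_mul_right, (S.queryLaw R).tsum_coe, one_mul]
  rw [h1, ← ENNReal.tsum_mul_left, ← ENNReal.tsum_add]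
  refine ENNReal.tsum_le_tsum fun q => ?_
  by_cases hq : S.queryLaw R q = 0
  · simp [hq]
  rw [mul_left_comm, ← mul_add]
  refine mul_le_mul_right ?_ _
  have e : (1 / (N : ℝ≥0∞)) = ENNReal.ofReal (1 / N) := by
    rw [ENNReal.ofReal_div_of_pos hN', ENNReal.ofReal_one, ENNReal.ofReal_natCast]
  have hnn : 0 ≤ ∑ n, S.condEntropy n (q n) (C ∪ R.1) :=
    Finset.sum_nonneg fun n _ => S.condEntropy_nonneg _ _ _
  rw [e, ← ENNReal.ofReal_mul (by positivity),
    ← ENNReal.ofReal_add hmono (mul_nonneg (by positivity) hnn)]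
  exact ENNReal.ofReal_le_ofReal
    (S.le_sum_condEntropy hS R ((S.queryLaw R).mem_support_iff q |>.2 hq) C)

theorem totalCondEntropy_empty_le (R : Request K P) :
    S.totalCondEntropy R ∅ ≤ ∑ n, entropy (S.answerLaw R n) := by
  unfold totalCondEntropy
  refine Finset.sum_le_sum fun n _ => ?_
  rw [answerLaw_eq]
  refine le_trans (le_of_eq (tsum_congr fun k => ?_)) (tsum_mul_entropy_le _ _)
  rw [filesLaw, entropy_map_uniform]
  congr 2
  rw [condEntropy, unifEntropy_of_subsingleton (innerProds (F := F) L ∅), sub_zero]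
  exact unifEntropy_congr fun W W' => by
    simp [eq_iff_true_of_subsingleton]

/-- The lower bound on the download, by peeling off disjoint requests one after the other. -/
theorem sum_le_totalCondEntropy (hS : S.IsCorrect) (hP : S.IsPrivate) (hN : 1 ≤ N)
    (R₀ : Request K P) (R : ℕ → Request K P) (C : ℕ → Finset (Sym2 (Fin K)))
    (M i : ℕ) (hC : ∀ j < i + M, i ≤ j → C (j + 1) = C j ∪ (R j).1) :
    ∑ j ∈ Finset.range M, (1 / (N : ℝ≥0∞)) ^ j * ENNReal.ofReal
      (unifEntropy (innerProds (F := F) L (C (i + j + 1))) -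
        unifEntropy (innerProds (F := F) L (C (i + j)))) ≤ S.totalCondEntropy R₀ (C i) := by
  induction M generalizing i with
  | zero => simp
  | succ M ih =>
    rw [Finset.sum_range_succ']
    refine le_trans ?_ (S.le_totalCondEntropy hS hP hN R₀ (R i) (C i))
    rw [add_comm]
    rw [← hC i (by omega) le_rfl]
    refine add_le_add (by simp) ?_
    refine le_trans (le_of_eq ?_) (mul_le_mul_right (ih (i + 1) fun j h1 h2 =>
      hC j (by omega) (by omega)) _)
    rw [Finset.mul_sum]
    refine Finset.sum_congr rfl fun j _ => ?_
    rw [pow_succ, mul_comm ((1 / (N : ℝ≥0∞)) ^ j), mul_assoc, show i + 1 + j = i + (j + 1) by ring]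

end Protocol

theorem card_pairs_dvd {M : ℕ} (hM : K * (K + 1) = 2 * P * M) :
    Fintype.card (Sym2 (Fin K)) = M * P := by
  rw [Sym2.card, Fintype.card_fin, Nat.choose_two_right, Nat.add_sub_cancel, mul_comm (K + 1), hM,
    mul_assoc, Nat.mul_div_cancel_left _ two_pos, mul_comm]

theorem exists_request_chain {M : ℕ} (hM : Fintype.card (Sym2 (Fin K)) = M * P) (hM1 : 1 ≤ M) :
    ∃ (R : ℕ → Request K P) (C : ℕ → Finset (Sym2 (Fin K))), C 0 = ∅ ∧
      (∀ j ≤ M, (C j).card = j * P) ∧ (∀ j < M, C (j + 1) = C j ∪ (R j).1) := by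
  let e := Fintype.equivFinOfCardEq hM
  let C : ℕ → Finset (Sym2 (Fin K)) := fun j =>
    Finset.univ.filter fun t => (e t : ℕ) < j * P
  have hcard : ∀ j ≤ M, (C j).card = j * P := by
    intro j hj
    have : (C j).card = (Finset.univ.filter fun x : Fin (M * P) => (x : ℕ) < j * P).card := by
      refine Finset.card_bij (fun t _ => e t) (fun t ht => ?_) (fun a _ b _ h => e.injective h)
        fun x hx => ⟨e.symm x, ?_, by simp⟩
      · simpa [C] using ht
      · simpa [C] using hx
    rw [this, Fin.card_filter_val_lt]
    exact min_eq_right (Nat.mul_le_mul_right _ hj)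
  have hsub : ∀ j, C j ⊆ C (j + 1) := by
    intro j t ht
    simp only [C, Finset.mem_filter, Finset.mem_univ, true_and] at ht ⊢
    exact ht.trans_le (Nat.mul_le_mul_right _ (Nat.le_succ _))
  have hR : ∀ j < M, (C (j + 1) \ C j).card = P := by
    intro j hj
    rw [Finset.card_sdiff_of_subset (hsub j), hcard _ hj, hcard _ hj.le, Nat.succ_mul]
    omega
  refine ⟨fun j => if h : j < M then ⟨C (j + 1) \ C j, hR j h⟩ else ⟨C 1 \ C 0, hR 0 hM1⟩, C,
    by simp [C], hcard, fun j hj => ?_⟩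
  simp only [dif_pos hj]
  exact (Finset.union_sdiff_of_subset (hsub j)).symm

theorem entropy_requested (R : Request K P) :
    entropy ((filesLaw F K L).map (requested R)) =
      ENNReal.ofReal (unifEntropy (innerProds (F := F) L R.1)) := by
  rw [filesLaw, entropy_map_uniform]
  rfl

theorem capacity_le (hN : 1 ≤ N) {M : ℕ} (R : ℕ → Request K P)
    (C : ℕ → Finset (Sym2 (Fin K))) (h0 : C 0 = ∅) (hC : ∀ j < M, C (j + 1) = C j ∪ (R j).1) :
    capacity F K L N P ≤ ENNReal.ofReal (unifEntropy (innerProds (F := F) L (R 0).1)) /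
      ∑ j ∈ Finset.range M, (1 / (N : ℝ≥0∞)) ^ j * ENNReal.ofReal
      (unifEntropy (innerProds (F := F) L (C (j + 1))) -
        unifEntropy (innerProds (F := F) L (C j))) := by
  refine iSup_le fun S => (iInf_le _ (R 0)).trans ?_
  rw [entropy_requested]
  refine ENNReal.div_le_div_left (le_trans ?_ (S.1.totalCondEntropy_empty_le (R 0))) _
  have := S.1.sum_le_totalCondEntropy S.2.1 S.2.2 hN (R 0) R C M 0 fun j h _ => hC j (by omega)
  rw [h0] at this
  exact le_trans (le_of_eq (Finset.sum_congr rfl fun j _ => by rw [Nat.zero_add])) this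

/-- The reciprocal of the capacity is asymptotically at least the claimed value. -/
theorem le_liminf_inv_capacity (hN : 1 ≤ N) (hP : 1 ≤ P) {M : ℕ} (hM1 : 1 ≤ M)
    (hM : Fintype.card (Sym2 (Fin K)) = M * P) :
    ∑ i ∈ Finset.range M, (1 / (N : ℝ≥0∞)) ^ i ≤
        liminf (fun L : ℕ => 1 / capacity F K L N P) atTop := by
  obtain ⟨R, C, h0, hcard, hC⟩ := exists_request_chain hM hM1
  set β : ℝ := P * Real.log (Fintype.card F) with hβ
  have hβpos : 0 < β :=
    mul_pos (by exact_mod_cast hP) (Real.log_pos (by exact_mod_cast Fintype.one_lt_card (α := F)))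
  have hlim : ∀ s : Finset (Sym2 (Fin K)), Tendsto
      (fun L : ℕ => unifEntropy (innerProds (F := F) L s)) atTop
      (𝓝 (s.card * Real.log (Fintype.card F))) := tendsto_entropy_innerProd
  have ha : Tendsto (fun L : ℕ => ENNReal.ofReal (unifEntropy (innerProds (F := F) L (R 0).1)))
      atTop (𝓝 (ENNReal.ofReal β)) := by
    have := hlim (R 0).1
    rw [(R 0).2] at this
    exact (ENNReal.continuous_ofReal.tendsto _).comp this
  have hb : Tendsto (fun L : ℕ => ∑ j ∈ Finset.range M, (1 / (N : ℝ≥0∞)) ^ j * ENNReal.ofReal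
      (unifEntropy (innerProds (F := F) L (C (j + 1))) -
        unifEntropy (innerProds (F := F) L (C j)))) atTop
      (𝓝 (∑ j ∈ Finset.range M, (1 / (N : ℝ≥0∞)) ^ j * ENNReal.ofReal β)) := by
    refine tendsto_finsetSum _ fun j hj => ?_
    have hj' := Finset.mem_range.1 hj
    refine ENNReal.Tendsto.const_mul ?_ (Or.inr ?_)
    · have := (hlim (C (j + 1))).sub (hlim (C j))
      rw [hcard _ hj', hcard _ hj'.le] at this
      refine ((ENNReal.continuous_ofReal.tendsto _).comp this).trans (le_of_eq ?_)
      congr 2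
      push_cast
      ring
    · refine ENNReal.pow_ne_top (ENNReal.div_ne_top ENNReal.one_ne_top ?_)
      exact_mod_cast (by omega : N ≠ 0)
  have hq := ENNReal.Tendsto.div hb (Or.inr ?_) ha (Or.inl ENNReal.ofReal_ne_top)
  · rw [← Finset.sum_mul, ENNReal.mul_div_cancel_right (by simpa using hβpos)
      ENNReal.ofReal_ne_top] at hq
    rw [← hq.liminf_eq]
    refine liminf_le_liminf (Eventually.of_forall fun L => ?_)
    have h := ENNReal.inv_le_inv.2 (capacity_le (F := F) (L := L) hN R C h0 hC)
    rw [one_div (capacity F K L N P)]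
    refine le_trans ?_ h
    by_cases hz : ∑ j ∈ Finset.range M, (1 / (N : ℝ≥0∞)) ^ j * ENNReal.ofReal
      (unifEntropy (innerProds (F := F) L (C (j + 1))) -
        unifEntropy (innerProds (F := F) L (C j))) = 0
    · simp only [hz, ENNReal.zero_div, zero_le]
    · rw [ENNReal.inv_div (Or.inr ENNReal.ofReal_ne_top) (Or.inl hz)]
  · simpa using hβpos

end Converse

/-! ### Generic vectors over large fields -/

section Generic

open MvPolynomial

theorem degreeOf_map_le_totalDegree {σ R S : Type*} [CommRing R] [CommRing S] (f : R →+* S)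
    (p : MvPolynomial σ R) (i : σ) : (map f p).degreeOf i ≤ p.totalDegree :=
  (degreeOf_le_totalDegree _ _).trans (Finset.sup_mono (support_map_subset _ _))

/-- An integer polynomial that is nonzero over a finite field with more elements than its degree
takes a nonzero value there. -/
theorem exists_eval_map_ne_zero {σ : Type*} [Finite σ] (Q : MvPolynomial σ ℤ) {F' : Type*}
    [Field F'] [Fintype F'] (hcard : Q.totalDegree < Fintype.card F')
    (hQ : map (Int.castRingHom F') Q ≠ 0) : ∃ x : σ → F', eval₂ (Int.castRingHom F') x Q ≠ 0 := by
  by_contra! h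
  refine hQ (eq_zero_of_eval_zero_at_prod_finset _ (fun _ => Finset.univ) (fun i => ?_)
    fun x _ => ?_)
  · exact (degreeOf_map_le_totalDegree _ _ _).trans_lt (by rwa [Finset.card_univ])
  · rw [eval_map, h]

theorem eval₂_det {ι σ R S : Type*} [Fintype ι] [DecidableEq ι] [CommRing R] [CommRing S]
    (f : R →+* S) (x : σ → S) (A : Matrix ι ι (MvPolynomial σ R)) :
    eval₂ f x A.det = (A.map (eval₂ f x)).det := by
  have := RingHom.map_det (eval₂Hom f x) A
  simpa using this

/-- Consider equations `e : E` in unknown vectors `x t`, `t : ρ`, of length `m`, where `e`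
involves the `x t` with `t ∈ D e`. If there are as many equations as scalar unknowns, the equations
can be matched with scalar unknowns occurring in them, and in each class of equations each unknown
vector occurs at most `m` times, then over each large field there are coefficient vectors for which
the system is nonsingular and the coefficient vectors of an unknown vector in the equations of one
class are independent. -/
theorem exists_generic_vectors {E ρ κ : Type*} [Fintype E] [DecidableEq E] [Fintype ρ]
    [DecidableEq ρ] [Fintype κ] [DecidableEq κ] (m : ℕ) (D : E → Finset ρ) (cl : E → κ)
    (hcl : ∀ n t, Fintype.card {e // cl e = n ∧ t ∈ D e} ≤ m)
    (θ : E → ρ × Fin m) (hθ : Function.Bijective θ) (hθD : ∀ e, (θ e).1 ∈ D e) :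
    ∃ B : ℕ, ∀ (F' : Type) [Field F'] [Fintype F'], B ≤ Fintype.card F' →
      ∃ v : E → ρ → Fin m → F',
        (∀ n t, LinearIndependent F' fun e : {e // cl e = n ∧ t ∈ D e} => v e t) ∧
        ∀ x : ρ → Module.Dual F' (Fin m → F'), (∀ e, ∑ t ∈ D e, x t (v e t) = 0) →
          ∀ t, x t = 0 := by
  classical
  have hj : ∀ n t, Nonempty ({e // cl e = n ∧ t ∈ D e} ↪ Fin m) := fun n t =>
    Function.Embedding.nonempty_of_card_le (by simpa using hcl n t)
  let j := fun n t => (hj n t).some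
  let A : Matrix E E (MvPolynomial (E × ρ × Fin m) ℤ) := fun e e' =>
    if (θ e').1 ∈ D e then X (e, θ e') else 0
  let A' : ∀ n t, Matrix {e // cl e = n ∧ t ∈ D e} {e // cl e = n ∧ t ∈ D e}
      (MvPolynomial (E × ρ × Fin m) ℤ) := fun n t e e' => X (e, t, j n t e')
  -- working over `ℤ` makes the bound on the degree independent of the field
  refine ⟨(A.det * ∏ n, ∏ t, (A' n t).det).totalDegree + 1, fun F' _ _ hB => ?_⟩
  have hA : map (Int.castRingHom F') A.det ≠ 0 := by
    intro h
    -- at the point given by the matching, `A` is the identity matrix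
    have h2 := congrArg (eval fun p : E × ρ × Fin m => if θ p.1 = p.2 then (1 : F') else 0) h
    rw [eval_map, eval₂_det, map_zero] at h2
    have h3 : A.map (eval₂ (Int.castRingHom F')
        fun p : E × ρ × Fin m => if θ p.1 = p.2 then (1 : F') else 0) = 1 := by
      ext e e'
      rw [Matrix.map_apply, Matrix.one_apply]
      simp only [A]
      by_cases he : e = e'
      · subst he
        simp [hθD e]
      · have : θ e ≠ θ e' := fun h => he (hθ.1 h)
        split_ifs <;> simp [this]
    rw [h3, Matrix.det_one] at h2
    exact one_ne_zero h2
  have hA' : ∀ n t, map (Int.castRingHom F') (A' n t).det ≠ 0 := by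
    intro n t h
    let y : E × ρ × Fin m → F' := fun p =>
      if h : cl p.1 = n ∧ t ∈ D p.1 then (if j n t ⟨p.1, h⟩ = p.2.2 then 1 else 0) else 0
    have h2 := congrArg (eval y) h
    rw [eval_map, eval₂_det, map_zero] at h2
    have h3 : (A' n t).map (eval₂ (Int.castRingHom F') y) = 1 := by
      ext e e'
      rw [Matrix.map_apply, Matrix.one_apply]
      simp only [A', eval₂_X, y, dif_pos e.2, Subtype.coe_eta, EmbeddingLike.apply_eq_iff_eq]
    rw [h3, Matrix.det_one] at h2
    exact one_ne_zero h2
  obtain ⟨v, hv⟩ := exists_eval_map_ne_zero (F' := F') (A.det * ∏ n, ∏ t, (A' n t).det) hB (by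
    rw [map_mul, map_prod]
    refine mul_ne_zero hA (Finset.prod_ne_zero_iff.2 fun n _ => ?_)
    rw [map_prod]
    exact Finset.prod_ne_zero_iff.2 fun t _ => hA' n t)
  rw [eval₂_mul] at hv
  have hv1 := left_ne_zero_of_mul hv
  have hv2 := right_ne_zero_of_mul hv
  rw [eval₂_prod, Finset.prod_ne_zero_iff] at hv2
  refine ⟨fun e t i => v (e, t, i), fun n t => ?_, fun x hx => ?_⟩
  · have h := hv2 n (Finset.mem_univ _)
    rw [eval₂_prod, Finset.prod_ne_zero_iff] at h
    have h := h t (Finset.mem_univ _)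
    rw [eval₂_det] at h
    refine LinearIndependent.of_comp (LinearMap.funLeft F' F' (j n t)) ?_
    have hrow : (LinearMap.funLeft F' F' (j n t) ∘
        fun (e : {e // cl e = n ∧ t ∈ D e}) i => v (e, t, i)) =
        fun e => (A' n t).map (eval₂ (Int.castRingHom F') v) e := by
      funext e e'
      rw [Matrix.map_apply]
      simp [A', LinearMap.funLeft]
    rw [hrow]
    exact Matrix.linearIndependent_rows_of_det_ne_zero h
  · have hexp : ∀ (φ : Module.Dual F' (Fin m → F')) (w : Fin m → F'),
        φ w = ∑ i, w i * φ (Pi.single i 1) := by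
      intro φ w
      conv_lhs => rw [← Finset.univ_sum_single w, map_sum]
      refine Finset.sum_congr rfl fun i _ => ?_
      rw [← smul_eq_mul, ← map_smul, ← Pi.single_smul, smul_eq_mul, mul_one]
    rw [eval₂_det] at hv1
    have hy := Matrix.eq_zero_of_mulVec_eq_zero hv1
      (v := fun e' => x (θ e').1 (Pi.single (θ e').2 1)) (by
        funext e
        rw [Pi.zero_apply, ← hx e]
        simp only [Matrix.mulVec, dotProduct, Matrix.map_apply]
        rw [hθ.sum_comp fun p => eval₂ (Int.castRingHom F') v (if p.1 ∈ D e then X (e, p) else 0) *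
          x p.1 (Pi.single p.2 1), Fintype.sum_prod_type, ← Finset.sum_subset (D e).subset_univ]
        · refine Finset.sum_congr rfl fun t ht => ?_
          rw [hexp (x t)]
          simp [ht]
        · intro t _ ht
          simp [ht])
    intro t
    refine LinearMap.pi_ext' fun i => ?_
    refine LinearMap.ext_ring ?_
    obtain ⟨e, he⟩ := hθ.2 (t, i)
    have := congrFun hy e
    simpa [he] using this

end Generic

/-! ### Weights of sums of symbols -/

section Weights

variable {τ : Type} [Fintype τ] [DecidableEq τ]

/-- `IsWeight N P T α`: among the subsets of a set of size `T`, when each set `A` carries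
`α |A|` labels, a set `B` disjoint from a given set `R` of size `P` is the trace outside `R`
of exactly `N` times as many labels as it carries itself. -/
def IsWeight (N P T : ℕ) (α : ℕ → ℕ) : Prop :=
  ∀ k, k + P ≤ T → ∑ i ∈ Finset.range (P + 1), P.choose i * α (k + i) = N * α k

/-- Weights exist: the recursion is solved from the top index downwards, clearing the denominator
`N - 1` in each step. -/
theorem exists_isWeight (N P T : ℕ) (hN : 1 ≤ N) (hP : 1 ≤ P) :
    ∃ α : ℕ → ℕ, IsWeight N P T α ∧ 0 < α 0 ∧ ∀ k, P ∣ α k := by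
  suffices h : ∃ α : ℕ → ℕ, IsWeight N P T α ∧ 0 < α 0 by
    obtain ⟨α, h1, h2⟩ := h
    refine ⟨fun k => P * α k, fun k hk => ?_, Nat.mul_pos hP h2, fun k => dvd_mul_right _ _⟩
    have := h1 k hk
    simp only [mul_left_comm _ P, ← Finset.mul_sum, this]
  induction T with
  | zero => exact ⟨fun _ => 1, fun k hk => by omega, one_pos⟩
  | succ T ih =>
    obtain ⟨α, h1, h2⟩ := ih
    let β : ℕ → ℕ := fun k => Nat.casesOn k
      (∑ i ∈ Finset.range P, P.choose (i + 1) * α i) fun k => (N - 1) * α k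
    have hβ0 : β 0 = ∑ i ∈ Finset.range P, P.choose (i + 1) * α i := rfl
    have hβ : ∀ k, β (k + 1) = (N - 1) * α k := fun _ => rfl
    refine ⟨β, fun k hk => ?_, ?_⟩
    · cases k with
      | zero =>
        rw [Finset.sum_range_succ']
        simp only [zero_add, hβ, mul_left_comm _ (N - 1), ← Finset.mul_sum, ← hβ0]
        rw [Nat.choose_zero_right, one_mul, ← Nat.succ_mul, Nat.succ_eq_add_one,
          Nat.sub_add_cancel hN]
      | succ k =>
        simp only [Nat.add_right_comm k 1, hβ, mul_left_comm _ (N - 1), ← Finset.mul_sum]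
        rw [h1 k (by omega)]
    · rw [hβ0]
      refine (Nat.mul_pos (Nat.choose_pos hP) h2).trans_le ?_
      exact Finset.single_le_sum (f := fun i => P.choose (i + 1) * α i)
        (fun i _ => Nat.zero_le _) (Finset.mem_range.2 hP)

omit [Fintype τ] in
theorem sum_powerset_union {β : Type*} [AddCommMonoid β] {U R : Finset τ} (h : Disjoint U R)
    (f : Finset τ → β) :
    ∑ A ∈ (U ∪ R).powerset, f A = ∑ B ∈ U.powerset, ∑ D ∈ R.powerset, f (B ∪ D) := by
  rw [← Finset.sum_product']
  refine Finset.sum_bij' (fun A _ => (A ∩ U, A ∩ R)) (fun p _ => p.1 ∪ p.2) ?_ ?_ ?_ ?_ ?_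
  · intro A _
    simp
  · rintro ⟨B, D⟩ hp
    simp only [Finset.mem_product, Finset.mem_powerset] at hp ⊢
    exact Finset.union_subset_union hp.1 hp.2
  · intro A hA
    rw [← Finset.inter_union_distrib_left]
    exact Finset.inter_eq_left.2 (Finset.mem_powerset.1 hA)
  · rintro ⟨B, D⟩ hp
    simp only [Finset.mem_product, Finset.mem_powerset] at hp
    have h1 : D ∩ U = ∅ := Finset.disjoint_iff_inter_eq_empty.1
      (h.symm.mono_left hp.2)
    have h2 : B ∩ R = ∅ := Finset.disjoint_iff_inter_eq_empty.1 (h.mono_left hp.1)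
    simp [Finset.union_inter_distrib_right, h1, h2, Finset.inter_eq_left.2 hp.1,
      Finset.inter_eq_left.2 hp.2]
  · intro A hA
    rw [← Finset.inter_union_distrib_left, Finset.inter_eq_left.2 (Finset.mem_powerset.1 hA)]

variable {N P T : ℕ} {α : ℕ → ℕ}

omit [Fintype τ] in
theorem IsWeight.sum_union (hα : IsWeight N P T α) {B R : Finset τ} (hR : R.card = P)
    (h : Disjoint B R) (hB : B.card + P ≤ T) :
    ∑ D ∈ R.powerset, α (B ∪ D).card = N * α B.card := by
  rw [← hα _ hB]
  have h1 : ∀ D ∈ R.powerset, α (B ∪ D).card = α (B.card + D.card) := fun D hD => by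
    rw [Finset.card_union_of_disjoint (h.mono_right (Finset.mem_powerset.1 hD))]
  rw [Finset.sum_congr rfl h1, Finset.sum_powerset_apply_card (fun i => α (B.card + i)), hR]
  simp only [smul_eq_mul]

omit [Fintype τ] in
theorem IsWeight.sum_powerset (hα : IsWeight N P T α) {U R : Finset τ} (hR : R.card = P)
    (h : Disjoint U R) (hU : U.card + P ≤ T) :
    ∑ A ∈ (U ∪ R).powerset, α A.card = N * ∑ A ∈ U.powerset, α A.card := by
  rw [sum_powerset_union h, Finset.mul_sum]
  refine Finset.sum_congr rfl fun B hB => ?_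
  have hB := Finset.mem_powerset.1 hB
  exact hα.sum_union hR (h.mono_left hB) (by have := Finset.card_le_card hB; omega)

omit [Fintype τ] in
theorem IsWeight.sum_powerset_eq_pow (hα : IsWeight N P T α) (j : ℕ) (hj : j * P ≤ T)
    {U : Finset τ} (hU : U.card = j * P) :
    ∑ A ∈ U.powerset, α A.card = N ^ j * α 0 := by
  induction j generalizing U with
  | zero =>
    rw [zero_mul, Finset.card_eq_zero] at hU
    simp [hU]
  | succ j ih =>
    rw [Nat.succ_mul] at hU hj
    obtain ⟨R, hRU, hR⟩ := Finset.exists_subset_card_eq (s := U) (n := P) (by omega)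
    have h1 : (U \ R).card = j * P := by
      rw [Finset.card_sdiff_of_subset hRU]; omega
    rw [← Finset.sdiff_union_of_subset hRU, hα.sum_powerset hR Finset.sdiff_disjoint (by omega),
      ih (by omega) h1, pow_succ]
    ring

/-- The number of labels that meet `R`, in terms of those that do not. -/
theorem sum_meet_add (R : Finset τ) :
    ∑ A ∈ Finset.univ.filter (fun A : Finset τ => (A ∩ R).Nonempty), α A.card +
      ∑ A ∈ Rᶜ.powerset, α A.card = ∑ A ∈ (Finset.univ : Finset τ).powerset, α A.card := by
  rw [Finset.powerset_univ, ← Finset.sum_filter_add_sum_filter_not Finset.univ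
    (fun A : Finset τ => (A ∩ R).Nonempty)]
  congr 2
  ext A
  rw [Finset.mem_powerset, Finset.mem_filter, Finset.not_nonempty_iff_eq_empty,
    ← Finset.disjoint_iff_inter_eq_empty, Finset.subset_compl_iff_disjoint_right]
  simp

/-- The total weight of the sets containing `t` is at most `N / P` times the total weight of the
sets meeting `R`: a given symbol index needs no more than `m` labels. -/
theorem IsWeight.sum_mem_le (hα : IsWeight N P T α) (hP : 1 ≤ P) (hT : Fintype.card τ = T)
    (hPT : 2 * P ≤ T) {R : Finset τ} (hR : R.card = P) (t : τ) :
    P * ∑ A ∈ Finset.univ.filter (fun A : Finset τ => t ∈ A), α A.card ≤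
      N * ∑ A ∈ Finset.univ.filter (fun A : Finset τ => (A ∩ R).Nonempty), α A.card := by
  let h : ℕ → ℕ := fun n => ∑ k ∈ Finset.range (n + 1), n.choose k • α (k + 1)
  have hmono : h (T - P - 1) ≤ h (T - P) := by
    refine (Finset.sum_le_sum fun k _ => ?_).trans
      (Finset.sum_le_sum_of_subset (Finset.range_subset_range.2 (by omega)))
    exact Nat.mul_le_mul_right _ (Nat.choose_le_choose _ (by omega))
  -- the recursion, applied to a set `R'` that avoids `t`, turns the weight of the sets containing `t`
  -- into `N * h (T - P - 1)`; applied to `R`, it shows that already the sets meeting `R` in a single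
  -- element weigh `P * h (T - P)`
  obtain ⟨R', hR't, hR'⟩ := Finset.exists_subset_card_eq (s := (Finset.univ : Finset τ).erase t)
    (n := P) (by rw [Finset.card_erase_of_mem (Finset.mem_univ t), Finset.card_univ]; omega)
  have ht : t ∉ R' := fun h => (Finset.mem_erase.1 (hR't h)).1 rfl
  have hdeg : ∑ A ∈ Finset.univ.filter (fun A : Finset τ => t ∈ A), α A.card = N * h (T - P - 1) := by
    have hU : (R'ᶜ).card + P ≤ T := by
      rw [Finset.card_compl]; omega
    rw [Finset.sum_filter, ← Finset.powerset_univ, ← Finset.union_compl R', Finset.union_comm,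
      sum_powerset_union disjoint_compl_left]
    have h1 : ∀ B ∈ R'ᶜ.powerset, ∑ D ∈ R'.powerset, (if t ∈ B ∪ D then α (B ∪ D).card else 0) =
        if t ∈ B then N * α B.card else 0 := by
      intro B hB
      have hB := Finset.mem_powerset.1 hB
      have hd : Disjoint B R' := disjoint_compl_left.mono_left hB
      split_ifs with htB
      · rw [← hα.sum_union hR' hd (by have := Finset.card_le_card hB; omega)]
        exact Finset.sum_congr rfl fun D _ => if_pos (Finset.mem_union_left _ htB)
      · refine Finset.sum_eq_zero fun D hD => if_neg ?_
        rw [Finset.mem_union, not_or]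
        exact ⟨htB, fun h => ht (Finset.mem_powerset.1 hD h)⟩
    rw [Finset.sum_congr rfl h1, ← Finset.insert_erase (Finset.mem_compl.2 ht),
      Finset.sum_powerset_insert (Finset.notMem_erase _ _), Finset.sum_eq_zero, zero_add]
    · have h2 : ∀ B ∈ (R'ᶜ.erase t).powerset, (if t ∈ insert t B then N * α (insert t B).card
          else 0) = N * α (B.card + 1) := by
        intro B hB
        rw [if_pos (Finset.mem_insert_self _ _), Finset.card_insert_of_notMem]
        exact fun h => Finset.notMem_erase _ _ (Finset.mem_powerset.1 hB h)
      rw [Finset.sum_congr rfl h2, ← Finset.mul_sum,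
        Finset.sum_powerset_apply_card (fun k => α (k + 1)),
        Finset.card_erase_of_mem (Finset.mem_compl.2 ht), Finset.card_compl, hT, hR']
    · intro B hB
      exact if_neg fun h => Finset.notMem_erase _ _ (Finset.mem_powerset.1 hB h)
  have hV : (Rᶜ).card = T - P := by rw [Finset.card_compl, hT, hR]
  have hmeet := sum_meet_add (α := α) R
  rw [← Finset.union_compl R, Finset.union_comm,
    hα.sum_powerset hR disjoint_compl_left (by omega)] at hmeet
  have hlow : ∑ A ∈ Rᶜ.powerset, α A.card + P * h (T - P) ≤ N * ∑ A ∈ Rᶜ.powerset, α A.card := by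
    have : h (T - P) = ∑ A ∈ Rᶜ.powerset, α (A.card + 1) := by
      rw [Finset.sum_powerset_apply_card (fun k => α (k + 1)), hV]
    rw [this, Finset.mul_sum, Finset.mul_sum, ← Finset.sum_add_distrib]
    refine Finset.sum_le_sum fun A hA => ?_
    have hA := Finset.card_le_card (Finset.mem_powerset.1 hA)
    rw [← hα A.card (by omega)]
    refine le_trans (le_of_eq ?_) (Finset.sum_le_sum_of_subset
      (Finset.range_subset_range.2 (by omega : 2 ≤ P + 1)))
    simp [Finset.sum_range_succ]
  rw [hdeg, mul_left_comm]
  refine Nat.mul_le_mul_left _ ((Nat.mul_le_mul_left _ hmono).trans ?_)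
  omega

end Weights

/-! ### Labels and their matching with unknowns -/

section Labels

variable {τ : Type} [Fintype τ] [DecidableEq τ]

/-- A label `(A, i)` stands for the `i`-th sum that combines symbols of exactly the messages in
`A`; there are `α |A|` labels for each nonempty set `A`. -/
abbrev Label (τ : Type) (α : ℕ → ℕ) : Type :=
  (A : {A : Finset τ // A.Nonempty}) × Fin (α A.1.card)

/-- The set of messages that a label combines. -/
abbrev Label.supp {α : ℕ → ℕ} (s : Label τ α) : Finset τ := s.1.1

variable {N P m : ℕ} {α : ℕ → ℕ}

omit [DecidableEq τ] in
theorem sum_label {β : Type*} [AddCommMonoid β] (g : Finset τ → β) (hg : g ∅ = 0) :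
    ∑ s : Label τ α, g s.supp = ∑ A, α A.card • g A := by
  rw [Fintype.sum_sigma]
  have h1 : ∀ A : {A : Finset τ // A.Nonempty}, ∑ i : Fin (α A.1.card), g (Label.supp ⟨A, i⟩) =
      α A.1.card • g A.1 := fun A => by
    change ∑ _i : Fin (α A.1.card), g A.1 = _
    rw [Finset.sum_const, Finset.card_univ, Fintype.card_fin]
  rw [Fintype.sum_congr _ _ h1, ← Finset.sum_subtype (Finset.univ.filter fun A : Finset τ =>
    A.Nonempty) (by simp) (fun A => α A.card • g A)]
  refine Finset.sum_subset (Finset.subset_univ _) fun A _ hA => ?_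
  rw [Finset.mem_filter, not_and, Finset.not_nonempty_iff_eq_empty] at hA
  rw [hA (Finset.mem_univ _), hg, smul_zero]

omit [DecidableEq τ] in
theorem card_label (p : Finset τ → Prop) [DecidablePred p] (hp : ¬ p ∅) :
    Fintype.card {s : Label τ α // p s.supp} = ∑ A ∈ Finset.univ.filter p, α A.card := by
  rw [Fintype.card_subtype, Finset.card_filter, sum_label (fun A => if p A then 1 else 0) (by
    simp [hp]), Finset.sum_filter]
  simp

/-- Hall's theorem in the fractional form: if each `e` distributes unit weight equally over `D e`
and each `t` receives weight `m`, then the `e` can be matched with `m` copies of the `t`. -/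
theorem exists_matching {E ρ : Type*} [Fintype E] [Fintype ρ] [DecidableEq ρ]
    (D : E → Finset ρ) (hD : ∀ e, (D e).Nonempty)
    (hW : ∀ t, ∑ e, (if t ∈ D e then ((D e).card : ℚ)⁻¹ else 0) = m) :
    ∃ θ : E → ρ × Fin m, Function.Bijective θ ∧ ∀ e, (θ e).1 ∈ D e := by
  classical
  have hunit : ∀ e, ∑ t ∈ D e, ((D e).card : ℚ)⁻¹ = 1 := fun e => by
    rw [Finset.sum_const, nsmul_eq_mul, mul_inv_cancel₀]
    exact_mod_cast (Finset.card_pos.2 (hD e)).ne'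
  have hE : Fintype.card E = Fintype.card (ρ × Fin m) := by
    have h1 : ∑ t, ∑ e, (if t ∈ D e then ((D e).card : ℚ)⁻¹ else 0) = Fintype.card E := by
      rw [Finset.sum_comm]
      simp only [Finset.sum_ite_mem, Finset.univ_inter, hunit]
      simp
    simp only [hW] at h1
    rw [Finset.sum_const, nsmul_eq_mul, Finset.card_univ] at h1
    rw [Fintype.card_prod, Fintype.card_fin]
    exact_mod_cast h1.symm
  obtain ⟨θ, hθ, hθD⟩ := (Finset.all_card_le_biUnion_card_iff_exists_injective
    fun e => D e ×ˢ (Finset.univ : Finset (Fin m))).1 fun X => by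
      have hsub : (X.biUnion D) ×ˢ (Finset.univ : Finset (Fin m)) ⊆
          X.biUnion fun e => D e ×ˢ (Finset.univ : Finset (Fin m)) := by
        rintro ⟨t, i⟩ h
        simpa using h
      refine le_trans ?_ (Finset.card_le_card hsub)
      rw [Finset.card_product, Finset.card_univ, Fintype.card_fin]
      have : (X.card : ℚ) ≤ (X.biUnion D).card * m := by
        calc (X.card : ℚ) = ∑ e ∈ X, ∑ t ∈ D e, ((D e).card : ℚ)⁻¹ := by simp [hunit]
          _ = ∑ e ∈ X, ∑ t ∈ X.biUnion D, if t ∈ D e then ((D e).card : ℚ)⁻¹ else 0 := by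
            refine Finset.sum_congr rfl fun e he => ?_
            rw [Finset.sum_ite_mem, Finset.inter_eq_right.2 (Finset.subset_biUnion_of_mem D he)]
          _ = ∑ t ∈ X.biUnion D, ∑ e ∈ X, if t ∈ D e then ((D e).card : ℚ)⁻¹ else 0 :=
            Finset.sum_comm
          _ ≤ ∑ t ∈ X.biUnion D, ∑ e, if t ∈ D e then ((D e).card : ℚ)⁻¹ else 0 := by
            refine Finset.sum_le_sum fun t _ => Finset.sum_le_sum_of_subset_of_nonneg
              X.subset_univ fun e _ _ => ?_
            split_ifs <;> positivity
          _ = _ := by simp [hW]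
      exact_mod_cast this
  refine ⟨θ, (Fintype.bijective_iff_injective_and_card θ).2 ⟨hθ, hE⟩, fun e => ?_⟩
  exact (Finset.mem_product.1 (hθD e)).1

/-- A set with `N` times as many elements as a subset `p` is covered by `N` permuted copies
of `p`. -/
theorem exists_perm_cover {X : Type*} [Fintype X] (p : X → Prop) [DecidablePred p]
    (h : Fintype.card X = N * Fintype.card {x // p x}) :
    ∃ π : Fin N → Equiv.Perm X, ∀ x, ∃ n y, p y ∧ π n y = x := by
  classical
  have e : X ≃ Fin N × {x // p x} := Fintype.equivOfCardEq (by simpa using h)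
  let f : ∀ n : Fin N, {x // p x} ≃ {x // (e x).1 = n} := fun n =>
    { toFun := fun y => ⟨e.symm (n, y), by simp⟩
      invFun := fun x => (e x.1).2
      left_inv := fun y => by simp
      right_inv := fun x => by
        obtain ⟨x, hx⟩ := x
        subst hx
        simp }
  refine ⟨fun n => (f n).extendSubtype, fun x => ⟨(e x).1, (e x).2, (e x).2.2, ?_⟩⟩
  rw [Equiv.extendSubtype_apply_of_mem _ _ (e x).2.2]
  simp [f]

/-- The alignment of interference: server `n` uses for the label `s` the symbols with index
`π n s`. Outside `R` the sum of these symbols is downloaded on its own from some server. -/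
theorem exists_alignment (hα : IsWeight N P (Fintype.card τ) α) {R : Finset τ} (hR : R.card = P) :
    ∃ π : Fin N → Label τ α → Label τ α,
      (∀ n s, (π n s).supp \ R = s.supp \ R) ∧ (∀ n, Function.Injective (π n)) ∧
      ∀ s', (s'.supp \ R).Nonempty → ∃ n s, Disjoint s.supp R ∧ π n s = s' := by
  classical
  -- by the recursion, `B` is the trace of `N` times as many labels as it carries itself
  have hcard : ∀ B : Finset τ, B.Nonempty → Disjoint B R →
      Fintype.card {s : Label τ α // s.supp \ R = B} =
        N * Fintype.card {s : {s : Label τ α // s.supp \ R = B} // s.1.supp = B} := by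
    intro B hB hd
    have h1 : Fintype.card {s : {s : Label τ α // s.supp \ R = B} // s.1.supp = B} =
        Fintype.card {s : Label τ α // s.supp = B} := by
      refine Fintype.card_congr (Equiv.subtypeSubtypeEquivSubtype
        (p := fun s : Label τ α => s.supp \ R = B) (q := fun s => s.supp = B) fun {s} hs => ?_)
      rw [hs]
      exact Finset.sdiff_eq_self_of_disjoint hd
    rw [h1, card_label (fun A => A \ R = B) (by simpa using hB.ne_empty.symm),
      card_label (fun A => A = B) hB.ne_empty.symm]
    rw [Finset.filter_eq', if_pos (Finset.mem_univ _), Finset.sum_singleton,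
      ← hα.sum_union hR hd (by
        rw [← hR, ← Finset.card_union_of_disjoint hd]; exact Finset.card_le_univ _)]
    refine Finset.sum_bij' (fun A _ => A ∩ R) (fun D _ => B ∪ D) ?_ ?_ ?_ ?_ ?_
    · intro A _
      simp
    · intro D hD
      rw [Finset.mem_filter]
      refine ⟨Finset.mem_univ _, ?_⟩
      rw [Finset.union_sdiff_distrib, Finset.sdiff_eq_empty_iff_subset.2 (Finset.mem_powerset.1 hD),
        Finset.union_empty, Finset.sdiff_eq_self_of_disjoint hd]
    · intro A hA
      rw [← (Finset.mem_filter.1 hA).2, Finset.sdiff_union_inter]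
    · intro D hD
      rw [Finset.union_inter_distrib_right, Finset.disjoint_iff_inter_eq_empty.1 hd,
        Finset.empty_union, Finset.inter_eq_left.2 (Finset.mem_powerset.1 hD)]
    · intro A hA
      rw [← (Finset.mem_filter.1 hA).2, Finset.sdiff_union_inter]
  have hex : ∀ B : Finset τ, ∃ π : Fin N → Equiv.Perm {s : Label τ α // s.supp \ R = B},
      B.Nonempty → Disjoint B R → ∀ x, ∃ n y, y.1.supp = B ∧ π n y = x := by
    intro B
    by_cases hB : B.Nonempty ∧ Disjoint B R
    · obtain ⟨π, hπ⟩ := exists_perm_cover _ (hcard B hB.1 hB.2)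
      exact ⟨π, fun _ _ => hπ⟩
    · exact ⟨fun _ => 1, fun h1 h2 => absurd ⟨h1, h2⟩ hB⟩
  choose π hπ using hex
  have hmem : ∀ n s, (π (s.supp \ R) n ⟨s, rfl⟩).1.supp \ R = s.supp \ R := fun n s =>
    (π (s.supp \ R) n ⟨s, rfl⟩).2
  have hval : ∀ n B (y : {s : Label τ α // s.supp \ R = B}),
      (π (y.1.supp \ R) n ⟨y.1, rfl⟩).1 = (π B n y).1 := by
    rintro n B ⟨y, rfl⟩
    rfl
  refine ⟨fun n s => (π (s.supp \ R) n ⟨s, rfl⟩).1, hmem, fun n s s' h => ?_, fun s' hs' => ?_⟩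
  · have hB : s'.supp \ R = s.supp \ R := by
      rw [← hmem n s, ← hmem n s']
      exact congrArg (fun s => Label.supp s \ R) h.symm
    have h' := (hval n (s.supp \ R) ⟨s', hB⟩).symm.trans h.symm
    exact (congrArg Subtype.val ((π (s.supp \ R) n).injective (Subtype.ext h'))).symm
  · obtain ⟨n, y, hy, hyx⟩ := hπ (s'.supp \ R) hs' Finset.sdiff_disjoint ⟨s', rfl⟩
    refine ⟨n, y.1, ?_, ?_⟩
    · rw [hy]; exact Finset.sdiff_disjoint
    · exact (hval n (s'.supp \ R) y).trans (congrArg Subtype.val hyx)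

end Labels

/-! ### The retrieval code -/

section Code

variable {τ : Type} [Fintype τ] [DecidableEq τ] {N M P m : ℕ} {α : ℕ → ℕ}

/-- Every `t ∈ R` receives the same share when each label that meets `R` splits its weight equally
among the elements of `R` it contains. -/
theorem sum_label_share (R : Finset τ) (hm : R.card * m =
      N * ∑ A ∈ Finset.univ.filter (fun A : Finset τ => (A ∩ R).Nonempty), α A.card)
    {t : τ} (ht : t ∈ R) :
    ∑ e : Fin N × Label τ α, (if t ∈ e.2.supp then ((e.2.supp ∩ R).card : ℚ)⁻¹ else 0) = m := by
  -- the share of `t` does not depend on `t ∈ R`, by the symmetry that swaps two elements of `R`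
  let w : τ → ℚ := fun t => ∑ A : Finset τ, α A.card • if t ∈ A then ((A ∩ R).card : ℚ)⁻¹ else 0
  have hw : ∀ t' ∈ R, w t' = w t := by
    intro t' ht'
    refine Fintype.sum_equiv (Equiv.finsetCongr (Equiv.swap t' t)) _ _ fun A => ?_
    have hR : R.map (Equiv.swap t' t).toEmbedding = R := by
      refine Finset.eq_of_subset_of_card_le (fun x hx => ?_) (by simp)
      obtain ⟨y, hy, rfl⟩ := Finset.mem_map.1 hx
      rw [Equiv.coe_toEmbedding, Equiv.swap_apply_def]
      split_ifs <;> assumption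
    have h1 : (A.map (Equiv.swap t' t).toEmbedding ∩ R).card = (A ∩ R).card := by
      conv_lhs => rw [← hR, ← Finset.map_inter, Finset.card_map]
    have h2 : t ∈ A.map (Equiv.swap t' t).toEmbedding ↔ t' ∈ A := by
      rw [Finset.mem_map_equiv]
      simp
    simp only [Equiv.finsetCongr_apply, Finset.card_map, h1, h2]
  have hsum : ∑ t' ∈ R, w t' =
      ∑ A ∈ Finset.univ.filter (fun A : Finset τ => (A ∩ R).Nonempty), (α A.card : ℚ) := by
    rw [Finset.sum_comm, Finset.sum_filter]
    refine Finset.sum_congr rfl fun A _ => ?_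
    rw [← Finset.smul_sum, Finset.sum_ite_mem, Finset.sum_const, Finset.inter_comm R A]
    split_ifs with h
    · rw [nsmul_eq_mul (A ∩ R).card, mul_inv_cancel₀, nsmul_eq_mul, mul_one]
      exact_mod_cast (Finset.card_pos.2 h).ne'
    · rw [Finset.not_nonempty_iff_eq_empty.1 h]
      simp
  rw [Finset.sum_congr rfl hw, Finset.sum_const, nsmul_eq_mul] at hsum
  have hRpos : (R.card : ℚ) ≠ 0 := by exact_mod_cast (Finset.card_pos.2 ⟨t, ht⟩).ne'
  rw [Fintype.sum_prod_type]
  simp only [Finset.sum_const, Finset.card_univ, Fintype.card_fin]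
  rw [sum_label (fun A => if t ∈ A then ((A ∩ R).card : ℚ)⁻¹ else 0) (by simp)]
  change N • w t = m
  have hm' : (R.card : ℚ) * m = N * (R.card * w t) := by
    rw [hsum]
    exact_mod_cast hm
  rw [nsmul_eq_mul]
  exact mul_left_cancel₀ hRpos (by rw [hm']; ring)

/-- A retrieval code for the request `R`: server `n` is asked, for each label `s`, for the sum over
`t ∈ s.supp` of the image of the vector `c n s t` under the message `t`, a linear functional on
`V`. At each server the vectors of one message are independent, and all the sums together
determine the messages in `R`. -/
structure IsCode {F' V : Type*} [Field F'] [AddCommGroup V] [Module F' V] (R : Finset τ)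
    (c : Fin N → Label τ α → τ → V) : Prop where
  linearIndependent : ∀ n t, LinearIndependent F' fun s : {s : Label τ α // t ∈ s.supp} => c n s t
  eq_zero : ∀ x : τ → Module.Dual F' V, (∀ n s, ∑ t ∈ s.supp, x t (c n s t) = 0) →
    ∀ t ∈ R, x t = 0

/-- Over large fields there is a code for each request. For `t ∉ R` the vectors are unit vectors,
permuted so that interference is aligned; for `t ∈ R` they are generic. -/
theorem exists_isCode (hα : IsWeight N P (Fintype.card τ) α) {R : Finset τ} (hR : R.card = P)
    (hm : P * m = N * ∑ A ∈ Finset.univ.filter (fun A : Finset τ => (A ∩ R).Nonempty), α A.card)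
    (hdeg : ∀ t : τ, ∑ A ∈ Finset.univ.filter (fun A : Finset τ => t ∈ A), α A.card ≤ m) :
    ∃ B : ℕ, ∀ (F' : Type) [Field F'] [Fintype F'], B ≤ Fintype.card F' →
      ∃ c : Fin N → Label τ α → τ → (Fin m → F'), IsCode (F' := F') R c := by
  classical
  have hcard : ∀ t, Fintype.card {s : Label τ α // t ∈ s.supp} ≤ m := fun t =>
    (card_label (fun A => t ∈ A) (Finset.notMem_empty t)).trans_le (hdeg t)
  let E := {e : Fin N × Label τ α // (e.2.supp ∩ R).Nonempty}
  let D : E → Finset {t // t ∈ R} := fun e => e.1.2.supp.subtype (· ∈ R)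
  have hDmem : ∀ (e : E) t, t ∈ D e ↔ t.1 ∈ e.1.2.supp := fun e t => Finset.mem_subtype
  have hDcard : ∀ e : E, (D e).card = (e.1.2.supp ∩ R).card := by
    intro e
    rw [Finset.card_subtype, ← Finset.filter_mem_eq_inter]
  obtain ⟨θ, hθ, hθD⟩ := exists_matching (m := m) D
    (fun e => by rw [← Finset.card_pos, hDcard, Finset.card_pos]; exact e.2) fun t => by
      rw [← sum_label_share (N := N) (α := α) R (by rw [hR, hm]) t.2]
      simp only [hDmem, hDcard]
      refine (Finset.sum_subtype (Finset.univ.filter fun e : Fin N × Label τ α =>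
        (e.2.supp ∩ R).Nonempty) (by simp) fun e : Fin N × Label τ α =>
        if t.1 ∈ e.2.supp then ((e.2.supp ∩ R).card : ℚ)⁻¹ else 0).symm.trans
        (Finset.sum_subset (Finset.subset_univ _) fun e _ he => if_neg fun h => he ?_)
      exact Finset.mem_filter.2 ⟨Finset.mem_univ _, t.1, Finset.mem_inter.2 ⟨h, t.2⟩⟩
  obtain ⟨B, hB⟩ := exists_generic_vectors m D (fun e => e.1.1) (fun n t => by
    refine (Fintype.card_le_of_injective (fun e => (⟨e.1.1.2, (hDmem _ _).1 e.2.2⟩ :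
      {s : Label τ α // t.1 ∈ s.supp})) fun e e' h => ?_).trans (hcard t.1)
    have h1 : e.1.1.2 = e'.1.1.2 := congrArg Subtype.val h
    exact Subtype.ext (Subtype.ext (Prod.ext (e.2.1.trans e'.2.1.symm) h1))) θ hθ hθD
  obtain ⟨π, hπ1, hπ2, hπ3⟩ := exists_alignment hα hR
  refine ⟨B, fun F' _ _ hF' => ?_⟩
  obtain ⟨v, hv1, hv2⟩ := hB F' hF'
  have hemb : ∀ t, Nonempty ({s : Label τ α // t ∈ s.supp} ↪ Fin m) := fun t =>
    Function.Embedding.nonempty_of_card_le (by simpa using hcard t)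
  let u : τ → Label τ α → Fin m → F' := fun t s =>
    if h : t ∈ s.supp then Pi.single ((hemb t).some ⟨s, h⟩) 1 else 0
  have hu : ∀ t, LinearIndependent F' fun s : {s : Label τ α // t ∈ s.supp} => u t s := by
    intro t
    have := (Pi.basisFun F' (Fin m)).linearIndependent.comp _ (hemb t).some.injective
    convert this using 2 with s
    simp only [u, dif_pos s.2, Function.comp_apply, Pi.basisFun_apply]
  let c : Fin N → Label τ α → τ → Fin m → F' := fun n s t =>
    if ht : t ∈ R then (if hs : (s.supp ∩ R).Nonempty then v ⟨(n, s), hs⟩ ⟨t, ht⟩ else 0)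
    else u t (π n s)
  have hmemπ : ∀ n s t, t ∉ R → (t ∈ (π n s).supp ↔ t ∈ s.supp) := by
    intro n s t ht
    have := Finset.ext_iff.1 (hπ1 n s) t
    simpa [ht] using this
  refine ⟨c, fun n t => ?_, fun x hx => ?_⟩
  · by_cases ht : t ∈ R
    · have := (hv1 n ⟨t, ht⟩).comp (fun s : {s : Label τ α // t ∈ s.supp} =>
        (⟨⟨(n, s.1), ⟨t, Finset.mem_inter.2 ⟨s.2, ht⟩⟩⟩, rfl, (hDmem _ _).2 s.2⟩ :
          {e : E // e.1.1 = n ∧ ⟨t, ht⟩ ∈ D e})) fun s s' h => by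
            have h1 := congrArg (fun e => e.1.1.2) h
            exact Subtype.ext h1
      have heq : (fun s : {s : Label τ α // t ∈ s.supp} => c n s t) = fun s =>
          v ⟨(n, s.1), ⟨t, Finset.mem_inter.2 ⟨s.2, ht⟩⟩⟩ ⟨t, ht⟩ := funext fun s => by
        have hs : (s.1.supp ∩ R).Nonempty := ⟨t, Finset.mem_inter.2 ⟨s.2, ht⟩⟩
        simp only [c, dif_pos ht, dif_pos hs]
      rw [heq]
      exact this
    · have := (hu t).comp (fun s : {s : Label τ α // t ∈ s.supp} =>
        (⟨π n s.1, (hmemπ n s.1 t ht).2 s.2⟩ : {s : Label τ α // t ∈ s.supp})) fun s s' h =>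
          Subtype.ext (hπ2 n (congrArg Subtype.val h))
      have heq : (fun s : {s : Label τ α // t ∈ s.supp} => c n s t) = fun s => u t (π n s.1) :=
        funext fun s => by simp only [c, dif_neg ht]
      rw [heq]
      exact this
  · -- all interference is known: each of its sums is some server's answer to a label outside `R`
    have hY : ∀ s' : Label τ α, ∑ t ∈ s'.supp \ R, x t (u t s') = 0 := by
      intro s'
      by_cases hs' : (s'.supp \ R).Nonempty
      · obtain ⟨n, s, hs, rfl⟩ := hπ3 s' hs'
        rw [← hx n s, hπ1, Finset.sdiff_eq_self_of_disjoint hs]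
        refine Finset.sum_congr rfl fun t ht => ?_
        simp only [c, dif_neg (Finset.disjoint_left.1 hs ht)]
      · rw [Finset.not_nonempty_iff_eq_empty.1 hs', Finset.sum_empty]
    have hzero := hv2 (fun t => x t.1) fun e => by
      have h1 := hx e.1.1 e.1.2
      rw [← Finset.sum_filter_add_sum_filter_not _ (· ∈ R)] at h1
      have h2 : ∑ t ∈ e.1.2.supp with t ∉ R, x t (c e.1.1 e.1.2 t) = 0 := by
        rw [← hY (π e.1.1 e.1.2), hπ1, ← Finset.filter_notMem_eq_sdiff]
        refine Finset.sum_congr rfl fun t ht => ?_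
        simp only [c, dif_neg (Finset.mem_filter.1 ht).2]
      rw [h2, add_zero, ← Finset.sum_subtype_eq_sum_filter] at h1
      rw [← h1]
      refine Finset.sum_congr rfl fun t _ => ?_
      simp only [c, dif_pos t.2, dif_pos e.2]
      rfl
    exact fun t ht => hzero ⟨t, ht⟩

/-- The parameters of the codes: with `m` symbols per message, the number of labels, which is the
number of symbols each server sends, is optimal. -/
theorem exists_codes (hN : 2 ≤ N) (hM : 2 ≤ M) (hP : 1 ≤ P) (hτ : Fintype.card τ = M * P) :
    ∃ (α : ℕ → ℕ) (m B : ℕ), 0 < m ∧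
      (N : ℝ) * Fintype.card (Label τ α) = P * m * ∑ i ∈ Finset.range M, (1 / (N : ℝ)) ^ i ∧
      ∀ (F' : Type) [Field F'] [Fintype F'], B ≤ Fintype.card F' → ∀ R : Finset τ, R.card = P →
        ∃ c : Fin N → Label τ α → τ → (Fin m → F'), IsCode (F' := F') R c := by
  classical
  obtain ⟨α, hα, hα0, hdvd⟩ := exists_isWeight N P (Fintype.card τ) (by omega) hP
  obtain ⟨a, ha⟩ := hdvd 0
  have ha0 : 0 < a := by
    rcases Nat.eq_zero_or_pos a with h | h
    · rw [h] at ha; omega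
    · exact h
  obtain ⟨M, rfl⟩ : ∃ M', M = M' + 1 := ⟨M - 1, by omega⟩
  obtain ⟨N', rfl⟩ : ∃ N', N = N' + 1 := ⟨N - 1, by omega⟩
  let m := (N' + 1) ^ (M + 1) * N' * a
  have huniv : ∑ A ∈ (Finset.univ : Finset τ).powerset, α A.card = (N' + 1) ^ (M + 1) * α 0 :=
    hα.sum_powerset_eq_pow (M + 1) hτ.ge (by rw [Finset.card_univ, hτ])
  have hmeet : ∀ R : Finset τ, R.card = P → P * m = (N' + 1) * ∑ A ∈ Finset.univ.filter
      (fun A : Finset τ => (A ∩ R).Nonempty), α A.card := by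
    intro R hR
    have h1 := sum_meet_add (α := α) R
    rw [huniv, hα.sum_powerset_eq_pow M (by rw [hτ, Nat.succ_mul]; omega)
      (by rw [Finset.card_compl, hτ, hR, Nat.succ_mul]; omega), pow_succ] at h1
    have h2 : ∑ A ∈ Finset.univ.filter (fun A : Finset τ => (A ∩ R).Nonempty), α A.card =
        (N' + 1) ^ M * N' * α 0 := by
      have : (N' + 1) ^ M * (N' + 1) * α 0 = (N' + 1) ^ M * N' * α 0 + (N' + 1) ^ M * α 0 := by
        ring
      omega
    rw [h2, ha]
    simp only [m]
    ring
  have hB : ∀ R : Finset τ, ∃ B : ℕ, ∀ (F' : Type) [Field F'] [Fintype F'],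
      B ≤ Fintype.card F' → R.card = P →
        ∃ c : Fin (N' + 1) → Label τ α → τ → (Fin m → F'), IsCode (F' := F') R c := by
    intro R
    by_cases hR : R.card = P
    · obtain ⟨B, hB⟩ := exists_isCode hα hR (hmeet R hR) fun t => by
        have h2P : 2 * P ≤ Fintype.card τ := by rw [hτ]; exact Nat.mul_le_mul_right _ hM
        have := hα.sum_mem_le hP rfl h2P hR t
        rw [← hmeet R hR] at this
        exact Nat.le_of_mul_le_mul_left this hP
      exact ⟨B, fun F' _ _ h _ => hB F' h⟩
    · exact ⟨0, fun F' _ _ _ h => absurd h hR⟩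
  choose B hB using hB
  refine ⟨α, m, Finset.univ.sup B, Nat.mul_pos (Nat.mul_pos (by positivity) (by omega)) ha0, ?_,
    fun F' _ _ h R hR =>
    hB R F' ((Finset.le_sup (Finset.mem_univ R)).trans h) hR⟩
  have hd : Fintype.card (Label τ α) + α 0 = (N' + 1) ^ (M + 1) * α 0 := by
    have h1 := sum_label (τ := τ) (α := α) (fun A : Finset τ => if A.Nonempty then 1 else 0) (by simp)
    rw [← huniv, Finset.powerset_univ,
      ← Finset.add_sum_erase _ _ (Finset.mem_univ (∅ : Finset τ)), add_comm,
      Finset.card_empty]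
    congr 1
    rw [← Finset.add_sum_erase _ _ (Finset.mem_univ (∅ : Finset τ))] at h1
    have h2 : ∑ s : Label τ α, (if s.supp.Nonempty then 1 else 0) = Fintype.card (Label τ α) := by
      rw [Finset.sum_congr rfl fun s _ => if_pos s.1.2]
      simp
    rw [← h2, h1]
    simp only [Finset.not_nonempty_empty, if_false, smul_zero, zero_add]
    refine Finset.sum_congr rfl fun A hA => ?_
    rw [if_pos (Finset.nonempty_iff_ne_empty.2 (Finset.mem_erase.1 hA).1), smul_eq_mul, mul_one]
  have hd' : (Fintype.card (Label τ α) : ℝ) = ((N' + 1 : ℝ) ^ (M + 1) - 1) * (P * a) := by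
    rw [ha] at hd
    have : (Fintype.card (Label τ α) : ℝ) + P * a = (N' + 1 : ℝ) ^ (M + 1) * (P * a) := by
      exact_mod_cast hd
    linarith
  have hx : (N' + 1 : ℝ) ≠ 0 := by positivity
  have hN0 : (N' : ℝ) ≠ 0 := by
    have : N' ≠ 0 := by omega
    exact_mod_cast this
  have hgeom : (N' + 1 : ℝ) ^ (M + 1) * N' * ∑ i ∈ Finset.range (M + 1), (1 / (N' + 1 : ℝ)) ^ i =
      (N' + 1) * ((N' + 1 : ℝ) ^ (M + 1) - 1) := by
    have := geom_sum_mul (1 / (N' + 1 : ℝ)) (M + 1)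
    have h3 : (1 / (N' + 1 : ℝ)) - 1 = - (N' / (N' + 1 : ℝ)) := by field_simp; ring
    have h4 : (N' + 1 : ℝ) ^ (M + 1) * (1 / (N' + 1 : ℝ)) ^ (M + 1) = 1 := by
      rw [← mul_pow, mul_one_div_cancel hx, one_pow]
    rw [h3] at this
    have h5 : (∑ i ∈ Finset.range (M + 1), (1 / (N' + 1 : ℝ)) ^ i) * N' =
      (N' + 1) * (1 - (1 / (N' + 1 : ℝ)) ^ (M + 1)) := by
      field_simp at this ⊢
      linarith
    rw [mul_assoc, mul_comm (N' : ℝ), h5]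
    linear_combination (-(N' + 1 : ℝ)) * h4
  rw [hd']
  simp only [m]
  push_cast
  linear_combination (-(P * a : ℝ)) * hgeom

end Code

/-! ### Protocols from codes -/

section Protocols

/-- An injective labelling of a finite alphabet by natural numbers. -/
noncomputable def encode {X : Type*} [Finite X] (x : X) : ℕ :=
  Finite.equivFin X x

theorem encode_injective {X : Type*} [Finite X] : Function.Injective (encode : X → ℕ) :=
  Fin.val_injective.comp (Finite.equivFin X).injective

theorem entropy_map_le {Ω α : Type*} (p : PMF Ω) (f : Ω → α) (s : Finset α) (h : ∀ ω, f ω ∈ s) :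
    entropy (p.map f) ≤ ENNReal.ofReal (Real.log s.card) := by
  refine entropy_le_log_card _ s fun a ha => ?_
  rw [PMF.apply_eq_zero_iff, PMF.mem_support_map_iff]
  rintro ⟨ω, _, rfl⟩
  exact ha (h ω)

theorem map_uniform_comp_equiv {G α : Type*} [Fintype G] [Nonempty G] (e : G ≃ G) (f : G → α) :
    (PMF.uniformOfFintype G).map (fun g => f (e g)) = (PMF.uniformOfFintype G).map f := by
  classical
  ext a
  simp only [PMF.map_apply, PMF.uniformOfFintype_apply]
  exact e.tsum_eq fun g => if a = f g then ((Fintype.card G : ℝ≥0∞)⁻¹) else 0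

/-- Two independent families differ by an automorphism. -/
theorem exists_linearEquiv_of_linearIndependent {k V ι : Type*} [Field k] [AddCommGroup V]
    [Module k V] [FiniteDimensional k V] {v w : ι → V} (hv : LinearIndependent k v)
    (hw : LinearIndependent k w) : ∃ g : V ≃ₗ[k] V, ∀ i, g (v i) = w i := by
  obtain ⟨g, hg⟩ := Submodule.exists_linearEquiv_restrict_eq
    ((Module.Basis.span hv).equiv (Module.Basis.span hw) (Equiv.refl ι))
  refine ⟨g, fun i => ?_⟩
  have h1 := hg (Module.Basis.span hv i)
  rw [Module.Basis.equiv_apply, Equiv.refl_apply, Module.Basis.span_apply,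
    Module.Basis.span_apply] at h1
  exact h1.symm

variable {F : Type*} [Field F] [Fintype F] {K L N P : ℕ}

namespace Protocol

theorem isCorrect_of_determines (S : Protocol F K L N P)
    (h : ∀ R, ∀ q ∈ (S.queryLaw R).support, ∀ W W', S.answers q W = S.answers q W' →
      requested R W = requested R W') : S.IsCorrect := by
  classical
  intro R
  refine ⟨fun q a => if h : ∃ W, S.answers q W = a then requested R h.choose else fun _ => 0,
    fun x hx => ?_⟩
  have hq : x.1 ∈ (S.queryLaw R).support := by
    rw [law, PMF.mem_support_bind_iff] at hx
    obtain ⟨q, hq, hx⟩ := hx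
    rw [PMF.mem_support_map_iff] at hx
    obtain ⟨W, _, rfl⟩ := hx
    exact hq
  have hex : ∃ W, S.answers x.1 W = S.answers x.1 x.2 := ⟨x.2, rfl⟩
  dsimp only
  rw [dif_pos hex]
  exact h R x.1 hq _ _ hex.choose_spec

theorem serverLaw_eq (S : Protocol F K L N P) (R : Request K P) (n : Fin N) :
    S.serverLaw R n = (S.queryLawAt R n).bind fun k =>
      (filesLaw F K L).map fun W => (k, S.answer n k W, W) := by
  unfold serverLaw law queryLawAt
  rw [PMF.map_bind, PMF.bind_map]
  simp only [PMF.map_comp, Function.comp_def]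

theorem isPrivate_of_queryLawAt (S : Protocol F K L N P)
    (h : ∀ R₁ R₂ n, S.queryLawAt R₁ n = S.queryLawAt R₂ n) : S.IsPrivate := fun R₁ R₂ n => by
  rw [serverLaw_eq, serverLaw_eq, h R₁ R₂ n]

end Protocol

/-- One server returns all inner products. -/
theorem exists_protocol_downloadAll (F : Type*) [Field F] [Fintype F] (K L N P : ℕ) (hN : 1 ≤ N) :
    ∃ S : Protocol F K L N P, S.IsCorrect ∧ S.IsPrivate ∧ ∀ R, ∑ n, entropy (S.answerLaw R n) ≤
      ENNReal.ofReal (Fintype.card (Sym2 (Fin K)) * Real.log (Fintype.card F)) := by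
  classical
  let n₀ : Fin N := ⟨0, hN⟩
  let S : Protocol F K L N P :=
    { queryLaw := fun _ => PMF.pure 0
      answer := fun n _ W => if n = n₀ then encode (innerProd W) else 0 }
  refine ⟨S, S.isCorrect_of_determines fun R q _ W W' h => ?_,
    S.isPrivate_of_queryLawAt fun _ _ _ => rfl, fun R => ?_⟩
  · have h0 := congrFun h n₀
    simp only [Protocol.answers, S, if_true] at h0
    funext t
    exact congrFun (encode_injective h0) t
  · rw [Finset.sum_eq_single n₀]
    · refine (entropy_map_le _ _ (Finset.univ.image (encode : (Sym2 (Fin K) → F) → ℕ))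
        fun x => ?_).trans ?_
      · simp [S]
      · rw [Finset.card_image_of_injective _ encode_injective, Finset.card_univ, Fintype.card_fun,
          Nat.cast_pow, Real.log_pow]
    · intro n _ hn
      rw [← nonpos_iff_eq_zero]
      refine (entropy_map_le _ _ {0} fun x => ?_).trans (by simp)
      simp [S, hn]
    · simp

/-- A code for each request gives a protocol: the vectors of each message are moved by a uniformly
random automorphism, which hides the code from each single server. -/
theorem exists_protocol_of_isCode {F' V : Type} [Field F'] [Fintype F'] [AddCommGroup V]
    [Module F' V] [Finite V] {α : ℕ → ℕ} (φ : F → Module.Dual F' V)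
    (hφ : Function.Injective φ) (c : Request K P → Fin N → Label (Sym2 (Fin K)) α →
      Sym2 (Fin K) → V) (hc : ∀ R, IsCode (F' := F') R.1 (c R)) (L : ℕ) :
    ∃ S : Protocol F K L N P, S.IsCorrect ∧ S.IsPrivate ∧ ∀ R, ∑ n, entropy (S.answerLaw R n) ≤
      ENNReal.ofReal (N * Fintype.card (Label (Sym2 (Fin K)) α) *
        Real.log (Fintype.card F')) := by
  classical
  have : FiniteDimensional F' V := Module.Finite.of_finite
  have : Finite (V ≃ₗ[F'] V) := DFunLike.finite _
  have : Fintype (Sym2 (Fin K) → V ≃ₗ[F'] V) := Fintype.ofFinite _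
  have : Nonempty (Sym2 (Fin K) → V ≃ₗ[F'] V) := ⟨fun _ => LinearEquiv.refl F' V⟩
  let query : (Label (Sym2 (Fin K)) α → Sym2 (Fin K) → V) → (Sym2 (Fin K) → V ≃ₗ[F'] V) →
      (Label (Sym2 (Fin K)) α → Sym2 (Fin K) → V) :=
    fun v g s t => if t ∈ s.supp then g t (v s t) else 0
  let S : Protocol F K L N P :=
    { queryLaw := fun R => (PMF.uniformOfFintype (Sym2 (Fin K) → V ≃ₗ[F'] V)).map
        fun g n => encode (query (c R n) g)
      answer := fun _ k W => encode fun s : Label (Sym2 (Fin K)) α =>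
        ∑ t ∈ s.supp, φ (innerProd W t) (Function.invFun
          (encode : (Label (Sym2 (Fin K)) α → Sym2 (Fin K) → V) → ℕ) k s t) }
  refine ⟨S, S.isCorrect_of_determines fun R q hq W W' h => ?_,
    S.isPrivate_of_queryLawAt fun R₁ R₂ n => ?_, fun R => ?_⟩
  · obtain ⟨g, _, rfl⟩ := (PMF.mem_support_map_iff _ _ _).1 hq
    have hx := (hc R).eq_zero
      (fun t => (φ (innerProd W t) - φ (innerProd W' t)) ∘ₗ (g t).toLinearMap) fun n s => by
        have h1 := congrFun (encode_injective (congrFun h n)) s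
        simp only [Function.leftInverse_invFun encode_injective _] at h1
        rw [← sub_eq_zero, ← Finset.sum_sub_distrib] at h1
        rw [← h1]
        refine Finset.sum_congr rfl fun t ht => ?_
        simp [query, ht]
    funext t
    have h1 := hx t.1 t.2
    have h2 : φ (innerProd W t) - φ (innerProd W' t) = 0 := by
      ext v
      have := LinearMap.congr_fun h1 ((g t).symm v)
      simpa using this
    exact hφ (sub_eq_zero.1 h2)
  · have hmap : ∀ R, S.queryLawAt R n = (PMF.uniformOfFintype (Sym2 (Fin K) → V ≃ₗ[F'] V)).map
        fun g => encode (query (c R n) g) := fun R => PMF.map_comp _ _ _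
    have hex : ∀ t, ∃ a : V ≃ₗ[F'] V, ∀ s : {s : Label (Sym2 (Fin K)) α // t ∈ s.supp},
        a (c R₂ n s t) = c R₁ n s t := fun t =>
      exists_linearEquiv_of_linearIndependent ((hc R₂).linearIndependent n t)
        ((hc R₁).linearIndependent n t)
    choose a ha using hex
    rw [hmap, hmap, ← map_uniform_comp_equiv
      (Equiv.piCongrRight fun t => Equiv.mulRight (a t)) fun g => encode (query (c R₂ n) g)]
    congr 1
    funext g
    congr 1
    funext s t
    simp only [query]
    split_ifs with ht
    · exact congrArg (g t) (ha t ⟨s, ht⟩).symm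
    · rfl
  · have hn : ∀ n, entropy (S.answerLaw R n) ≤ ENNReal.ofReal
        (Fintype.card (Label (Sym2 (Fin K)) α) * Real.log (Fintype.card F')) := by
      intro n
      refine (entropy_map_le _ _ (Finset.univ.image
        (encode : (Label (Sym2 (Fin K)) α → F') → ℕ)) fun x => ?_).trans ?_
      · exact Finset.mem_image_of_mem _ (Finset.mem_univ _)
      · rw [Finset.card_image_of_injective _ encode_injective, Finset.card_univ, Fintype.card_fun,
          Nat.cast_pow, Real.log_pow]
    refine (Finset.sum_le_sum fun n _ => hn n).trans (le_of_eq ?_)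
    rw [Finset.sum_const, Finset.card_univ, Fintype.card_fin, nsmul_eq_mul,
      mul_assoc (N : ℝ), ENNReal.ofReal_mul (p := (N : ℝ)) (Nat.cast_nonneg _),
      ENNReal.ofReal_natCast]

/-- Protocols of bounded download bound the reciprocal of the capacity. -/
theorem limsup_inv_capacity_le (hP : 1 ≤ P) {D : ℝ} (hD : 0 < D)
    (h : ∀ L, ∃ S : Protocol F K L N P, S.IsCorrect ∧ S.IsPrivate ∧
      ∀ R, ∑ n, entropy (S.answerLaw R n) ≤ ENNReal.ofReal D) :
    limsup (fun L : ℕ => 1 / capacity F K L N P) atTop ≤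
      ENNReal.ofReal (D / (P * Real.log (Fintype.card F))) := by
  classical
  set β : ℝ := P * Real.log (Fintype.card F) with hβ
  have hβpos : 0 < β := mul_pos (by exact_mod_cast hP)
    (Real.log_pos (by exact_mod_cast Fintype.one_lt_card (α := F)))
  have hDpos : ENNReal.ofReal D ≠ 0 := by simpa using hD
  let H : ℕ → ℝ≥0∞ := fun L => Finset.univ.inf fun R : Request K P =>
    ENNReal.ofReal (unifEntropy (innerProds (F := F) L R.1))
  have hcap : ∀ L, 1 / capacity F K L N P ≤ ENNReal.ofReal D / H L := by
    intro L
    obtain ⟨S, h1, h2, h3⟩ := h L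
    have : H L / ENNReal.ofReal D ≤ capacity F K L N P := by
      refine le_trans (le_iInf fun R => ?_) (le_iSup (fun S : {S : Protocol F K L N P //
        S.IsCorrect ∧ S.IsPrivate} => S.1.rate) ⟨S, h1, h2⟩)
      rw [entropy_requested]
      exact ENNReal.div_le_div (Finset.inf_le (Finset.mem_univ R)) (h3 R)
    rw [one_div, ← ENNReal.inv_div (Or.inl ENNReal.ofReal_ne_top) (Or.inl hDpos)]
    exact ENNReal.inv_le_inv.2 this
  have hH : Tendsto H atTop (𝓝 (Finset.univ.inf fun _ : Request K P => ENNReal.ofReal β)) := by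
    refine Tendsto.finset_inf_nhds_apply fun R _ => ?_
    have := tendsto_entropy_innerProd (F := F) R.1
    rw [R.2] at this
    exact (ENNReal.continuous_ofReal.tendsto _).comp this
  have hlim := ENNReal.Tendsto.div tendsto_const_nhds (Or.inl hDpos) hH
    (Or.inr ENNReal.ofReal_ne_top)
  refine (limsup_le_limsup (Eventually.of_forall hcap)).trans ?_
  rw [hlim.limsup_eq, ENNReal.ofReal_div_of_pos hβpos]
  exact ENNReal.div_le_div_left (Finset.le_inf fun _ _ => le_rfl) _

end Protocols

/-! ### Choice of the code field -/

section FieldChoice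

variable {K N P M : ℕ}

theorem ofReal_sum_geom (hN : 1 ≤ N) (M : ℕ) :
    ENNReal.ofReal (∑ i ∈ Finset.range M, (1 / (N : ℝ)) ^ i) =
      ∑ i ∈ Finset.range M, (1 / (N : ℝ≥0∞)) ^ i := by
  rw [ENNReal.ofReal_sum_of_nonneg fun i _ => by positivity]
  refine Finset.sum_congr rfl fun i _ => ?_
  rw [ENNReal.ofReal_pow (by positivity), ENNReal.ofReal_div_of_pos (by exact_mod_cast hN),
    ENNReal.ofReal_one, ENNReal.ofReal_natCast]

/-- If the elements of `F` can be written as `m` symbols of a large field `F'`, the reciprocal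
capacity exceeds the claimed value at most by the factor lost in this representation. -/
theorem exists_limsup_bound.{u} (hN : 1 ≤ N) (hP : 1 ≤ P) (hM : 1 ≤ M)
    (hT : Fintype.card (Sym2 (Fin K)) = M * P) :
    ∃ m B : ℕ, 0 < m ∧ ∀ (F : Type u) [Field F] [Fintype F] (F' : Type) [Field F'] [Fintype F'],
      B ≤ Fintype.card F' → Fintype.card F ≤ Fintype.card F' ^ m →
      limsup (fun L : ℕ => 1 / capacity F K L N P) atTop ≤
        ENNReal.ofReal ((∑ i ∈ Finset.range M, (1 / (N : ℝ)) ^ i) *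
          (m * Real.log (Fintype.card F') / Real.log (Fintype.card F))) := by
  classical
  have hlogF : ∀ (F : Type u) [Field F] [Fintype F], 0 < Real.log (Fintype.card F) := fun F _ _ =>
    Real.log_pos (by exact_mod_cast Fintype.one_lt_card (α := F))
  have hP0 : (0 : ℝ) < P := by exact_mod_cast hP
  by_cases hcase : 2 ≤ N ∧ 2 ≤ M
  · obtain ⟨α, m, B, hm, hd, hcode⟩ := exists_codes hcase.1 hcase.2 hP hT
    refine ⟨m, B, hm, fun F _ _ F' _ _ hB hq => ?_⟩
    have hF := hlogF F
    have hF' : 0 < Real.log (Fintype.card F') :=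
      Real.log_pos (by exact_mod_cast Fintype.one_lt_card (α := F'))
    choose c hc using fun R : Request K P => hcode F' hB R.1 R.2
    have : Finite (Module.Dual F' (Fin m → F')) := (dotProductEquiv F' (Fin m)).toEquiv.finite_iff.1
      inferInstance
    have : Fintype (Module.Dual F' (Fin m → F')) := Fintype.ofFinite _
    obtain ⟨φ⟩ : Nonempty (F ↪ Module.Dual F' (Fin m → F')) := by
      refine Function.Embedding.nonempty_of_card_le ?_
      rw [← Fintype.card_congr (dotProductEquiv F' (Fin m)).toEquiv, Fintype.card_fun,
        Fintype.card_fin]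
      exact hq
    have hS : 0 < ∑ i ∈ Finset.range M, (1 / (N : ℝ)) ^ i :=
      Finset.sum_pos (fun i _ => by
        have : (0 : ℝ) < N := by exact_mod_cast hN
        positivity) ⟨0, Finset.mem_range.2 hM⟩
    refine (limsup_inv_capacity_le hP ?_
      fun L => exists_protocol_of_isCode φ φ.injective c hc L).trans (le_of_eq ?_)
    · rw [hd]
      positivity
    · rw [hd]
      congr 1
      rw [mul_assoc (P : ℝ), mul_assoc (P : ℝ), mul_div_mul_left _ _ hP0.ne']
      ring
  · refine ⟨1, 0, one_pos, fun F _ _ F' _ _ _ hq => ?_⟩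
    have hF := hlogF F
    have hsum : ∑ i ∈ Finset.range M, (1 / (N : ℝ)) ^ i = M := by
      rcases (by omega : N = 1 ∨ M = 1) with rfl | rfl <;> simp
    refine (limsup_inv_capacity_le hP ?_
      fun L => exists_protocol_downloadAll F K L N P hN).trans (ENNReal.ofReal_le_ofReal ?_)
    · rw [hT]
      have : (0 : ℝ) < (M * P : ℕ) := by exact_mod_cast Nat.mul_pos hM hP
      positivity
    · rw [hsum, hT, Nat.cast_mul]
      have h1 : (M * P : ℝ) * Real.log (Fintype.card F) / (P * Real.log (Fintype.card F)) =
          M * 1 := by field_simp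
      rw [h1]
      refine mul_le_mul_of_nonneg_left ?_ (Nat.cast_nonneg _)
      rw [le_div_iff₀ hF, one_mul, Nat.cast_one, one_mul]
      refine Real.log_le_log (by exact_mod_cast Fintype.card_pos) ?_
      rw [pow_one] at hq
      exact_mod_cast hq

/-- If `q = b ^ (m * k)`, the field with `b ^ k` elements represents the elements of `F` by exactly
`m` symbols. -/
theorem exists_root_field (F : Type*) [Field F] [Fintype F] {b m k : ℕ} (hm : 0 < m) (hk : 0 < k)
    (h : Fintype.card F = b ^ (m * k)) :
    ∃ (F' : Type) (_ : Field F') (_ : Fintype F'), 2 ^ k ≤ Fintype.card F' ∧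
      Fintype.card F = Fintype.card F' ^ m := by
  obtain ⟨n, hp, hn⟩ := FiniteField.card F (ringChar F)
  set p := ringChar F
  have hb : b ∣ p ^ (n : ℕ) := by
    rw [← hn, h]
    exact dvd_pow_self b (Nat.mul_pos hm hk).ne'
  obtain ⟨j, _, rfl⟩ := (Nat.dvd_prime_pow hp).1 hb
  have hj : j ≠ 0 := by
    rintro rfl
    have := Fintype.one_lt_card (α := F)
    rw [h] at this
    simp at this
  have : Fact p.Prime := ⟨hp⟩
  have hjk : j * k ≠ 0 := Nat.mul_ne_zero hj hk.ne'
  have hfin : Finite (GaloisField p (j * k)) := Nat.finite_of_card_ne_zero (by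
    rw [GaloisField.card p _ hjk]
    exact pow_ne_zero _ hp.ne_zero)
  refine ⟨GaloisField p (j * k), inferInstance, Fintype.ofFinite _, ?_, ?_⟩
  · rw [Fintype.card_eq_nat_card, GaloisField.card p _ hjk]
    exact (Nat.pow_le_pow_left hp.two_le k).trans (Nat.pow_le_pow_right hp.pos
      (Nat.le_mul_of_pos_left k (Nat.pos_of_ne_zero hj)))
  · rw [Fintype.card_eq_nat_card (α := GaloisField p (j * k)), GaloisField.card p _ hjk, h,
      ← pow_mul, ← pow_mul]
    congr 1
    ring

/-- By Bertrand's postulate there is a prime whose `m`-th power lies between `q` and `4 ^ m * q`. -/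
theorem exists_prime_pow_between {q m : ℕ} (hq : 2 ≤ q) (hm : 0 < m) :
    ∃ p : ℕ, p.Prime ∧ q ≤ p ^ m ∧ p ^ m ≤ 4 ^ m * q := by
  have hex : ∃ x : ℕ, q ≤ x ^ m := ⟨q, Nat.le_self_pow hm.ne' q⟩
  classical
  set x := Nat.find hex with hx
  have h1 : q ≤ x ^ m := Nat.find_spec hex
  have h2 : 2 ≤ x := by
    by_contra! h
    have : x ^ m ≤ 1 := Nat.pow_le_one_iff hm.ne' |>.2 (by omega)
    omega
  have h3 : (x - 1) ^ m < q := not_le.1 (Nat.find_min hex (m := x - 1) (by omega))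
  obtain ⟨p, hp, hp1, hp2⟩ := Nat.exists_prime_lt_and_le_two_mul x (by omega)
  refine ⟨p, hp, h1.trans (Nat.pow_le_pow_left hp1.le m), ?_⟩
  calc p ^ m ≤ (4 * (x - 1)) ^ m := Nat.pow_le_pow_left (by omega) m
    _ = 4 ^ m * (x - 1) ^ m := mul_pow _ _ _
    _ ≤ _ := Nat.mul_le_mul_left _ h3.le

end FieldChoice

end InnerProductRetrieval

open InnerProductRetrieval in
theorem corollary2 (K N P : ℕ) (hK : 1 ≤ K) (hN : 1 ≤ N) (hP : 1 ≤ P)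
    (hdvd : 2 * P ∣ K * (K + 1)) :
    -- for every field, asymptotically the reciprocal capacity is at least the claimed value
    (∀ (F : Type*) [Field F] [Fintype F],
      ∑ i ∈ Finset.range (K * (K + 1) / (2 * P)), (1 / (N : ℝ≥0∞)) ^ i ≤
        liminf (fun L : ℕ => 1 / InnerProductRetrieval.capacity F K L N P) atTop) ∧
    -- exact limit over all fields whose elements split into a suitable number of equal parts
    (∃ m : ℕ, 1 ≤ m ∧ ∀ (F : Type*) [Field F] [Fintype F],
      (∃ b : ℕ, Fintype.card F = b ^ m) →
        Tendsto (fun L : ℕ => 1 / InnerProductRetrieval.capacity F K L N P) atTop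
          (𝓝 (∑ i ∈ Finset.range (K * (K + 1) / (2 * P)), (1 / (N : ℝ≥0∞)) ^ i))) ∧
    -- limit up to an arbitrarily small error over all sufficiently large fields
    (∀ ε : ℝ≥0∞, 0 < ε → ∃ q₀ : ℕ, ∀ (F : Type*) [Field F] [Fintype F],
      q₀ ≤ Fintype.card F →
        limsup (fun L : ℕ => 1 / InnerProductRetrieval.capacity F K L N P) atTop ≤
          ∑ i ∈ Finset.range (K * (K + 1) / (2 * P)), (1 / (N : ℝ≥0∞)) ^ i + ε) := by
  obtain ⟨M, hM⟩ := hdvd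
  have hT := card_pairs_dvd hM
  have hM1 : 1 ≤ M := by
    rcases Nat.eq_zero_or_pos M with h | h
    · rw [h, mul_zero] at hM
      have : 0 < K * (K + 1) := Nat.mul_pos hK K.succ_pos
      omega
    · exact h
  rw [hM, Nat.mul_div_cancel_left _ (by omega)]
  refine ⟨fun F _ _ => le_liminf_inv_capacity hN hP hM1 hT, ?_, fun ε hε => ?_⟩
  · obtain ⟨m, B, hm, hbound⟩ := exists_limsup_bound hN hP hM1 hT
    refine ⟨m * (B + 1), Nat.mul_pos hm B.succ_pos, fun F _ _ ⟨b, hb⟩ => ?_⟩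
    obtain ⟨F', _, _, hB, hcard⟩ := exists_root_field F hm B.succ_pos hb
    refine tendsto_of_le_liminf_of_limsup_le (le_liminf_inv_capacity hN hP hM1 hT) ?_
    have h2B : B ≤ Fintype.card F' := by
      have := Nat.lt_two_pow_self (n := B + 1)
      omega
    refine (hbound F F' h2B hcard.le).trans (le_of_eq ?_)
    have hlog : 0 < Real.log (Fintype.card F) :=
      Real.log_pos (by exact_mod_cast Fintype.one_lt_card (α := F))
    rw [← ofReal_sum_geom hN, ← Real.log_pow, ← Nat.cast_pow, ← hcard, div_self hlog.ne', mul_one]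
  · obtain ⟨m, B, hm, hbound⟩ := exists_limsup_bound hN hP hM1 hT
    set s : ℝ := ∑ i ∈ Finset.range M, (1 / (N : ℝ)) ^ i with hs
    have hs0 : 0 ≤ s := Finset.sum_nonneg fun i _ => by positivity
    -- `ε` may be infinite
    obtain ⟨δ, hδ, hδε⟩ : ∃ δ : ℝ, 0 < δ ∧ ENNReal.ofReal δ ≤ ε := by
      refine ⟨(min ε 1).toReal, ENNReal.toReal_pos (lt_min hε one_pos).ne' (by simp), ?_⟩
      rw [ENNReal.ofReal_toReal (by simp)]
      exact min_le_left _ _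
    refine ⟨max (max 2 (B ^ m)) ⌈Real.exp (s * (m * Real.log 4) / δ)⌉₊, fun F _ _ hq => ?_⟩
    have hq2 : 2 ≤ Fintype.card F := (le_max_left _ _).trans ((le_max_left _ _).trans hq)
    have hqB : B ^ m ≤ Fintype.card F := (le_max_right _ _).trans ((le_max_left _ _).trans hq)
    have hqexp : Real.exp (s * (m * Real.log 4) / δ) ≤ Fintype.card F :=
      (Nat.le_ceil _).trans (by exact_mod_cast (le_max_right _ _).trans hq)
    obtain ⟨p, hp, hp1, hp2⟩ := exists_prime_pow_between hq2 hm
    have : Fact p.Prime := ⟨hp⟩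
    have hlog : 0 < Real.log (Fintype.card F) :=
      Real.log_pos (by exact_mod_cast Fintype.one_lt_card (α := F))
    refine (hbound F (ZMod p) ?_ ?_).trans ?_
    · rw [ZMod.card]
      exact (Nat.pow_le_pow_iff_left hm.ne').1 (hqB.trans hp1)
    · rw [ZMod.card]
      exact hp1
    rw [← ofReal_sum_geom hN, ← hs]
    refine le_trans ?_ (add_le_add le_rfl hδε)
    rw [← ENNReal.ofReal_add hs0 hδ.le, ZMod.card]
    refine ENNReal.ofReal_le_ofReal ?_
    have h1 : (m : ℝ) * Real.log p ≤ m * Real.log 4 + Real.log (Fintype.card F) := by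
      have hp0 : (0 : ℝ) < p := by exact_mod_cast hp.pos
      have hq0 : (0 : ℝ) < Fintype.card F := by positivity
      rw [← Real.log_pow, ← Real.log_pow, ← Real.log_mul (by positivity) hq0.ne']
      refine Real.log_le_log (by positivity) ?_
      exact_mod_cast hp2
    have h2 : s * (m * Real.log 4) ≤ δ * Real.log (Fintype.card F) := by
      have := (Real.le_log_iff_exp_le (by positivity)).2 hqexp
      rwa [div_le_iff₀ hδ, mul_comm _ δ] at this
    rw [← mul_div_assoc, div_le_iff₀ hlog]
    nlinarith [mul_le_mul_of_nonneg_left h1 hs0]
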